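/- Let $\alpha,\pi_0\in(0,1)$ with $\pi_0>\frac{2^{\alpha}-1}{2^{\alpha+1}-1}$. Put $$f_0=1-\frac{1-\pi_0}{\pi_0}\bigl(1-2^{-\alpha}\bigr),\qquad f_k=\frac{1-\pi_0}{\pi_0}\bigl[k^{-\alpha}-2(k+1)^{-\alpha}+(k+2)^{-\alpha}\bigr]\quad(k\ge 1).$$ Then $f_k\ge 0$ for all $k\ge0$ and $\sum_{k\ge0}f_k=1$. Consider the Markov chain $(X_i)_{i\ge0}$ on $\{0,1,2,\dots\}$ that moves from state $0$ to state $j$ with probability $f_j$ and from state $i\ge1$ to state $i-1$ with probability $1$. Below, $a_n\sim b_n$ means $a_n/b_n\to1$ as $n\to\infty$. (a) Suppose that $\mathbb P(X_0=0)>0$ and condition on $X_0=0$. Let $F(n)$ be the probability that the first return to state $0$ takes at most $n$ steps, and let $N_n$ be the number of $i\in\{1,\dots,n\}$ with $X_i=0$. Then $$1-F(n)\sim\frac{\alpha(1-\pi_0)}{\pi_0}\,n^{-(1+\alpha)},\qquad \operatorname{Var}N_n\sim\frac{2\alpha\pi_0^2(1-\pi_0)}{(1-\alpha)(2-\alpha)}\,n^{2-\alpha}.$$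 (b) The chain can be started in equilibrium, that is, with $X_0$ distributed according to an invariant probability distribution. Whenever it is, the binary series $Y_i=1_{\{X_i\ne0\}}$ is weakly stationary, $\mathbb E\,Y_i=1-\pi_0$ for all $i$, and its autocorrelation function $\rho(n)=\operatorname{Cov}(Y_0,Y_n)/\operatorname{Var}(Y_0)$ satisfies $$\rho(n)\sim C\,n^{-\alpha}$$ for a constant $C>0$ depending only on $\pi_0$ and $\alpha$. In particular $\sum_{n\in\mathbb Z}|\rho(n)|=\infty$ (with $\rho(-n)=\rho(n)$). Hence $(Y_i)$ is long-range dependent with Hurst parameter $H=1-\alpha/2$, where $H$ is defined by $H=1-a/2$ whenever $\rho(n)\sim c\,n^{-a}$ for some $c>0$ and $a\in(0,1)$. -/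

import Mathlib

open MeasureTheory ProbabilityTheory Filter Asymptotics

noncomputable section

namespace LRDChain

/-- The jump probabilities `f k` from state `0`, with parameters `π₀` and `α`. -/
def jumpProb (π₀ α : ℝ) (k : ℕ) : ℝ :=
  if k = 0 then 1 - (1 - π₀) / π₀ * (1 - (2 : ℝ) ^ (-α))
  else (1 - π₀) / π₀ *
    ((k : ℝ) ^ (-α) - 2 * ((k : ℝ) + 1) ^ (-α) + ((k : ℝ) + 2) ^ (-α))

/-- The transition matrix on `ℕ`: from `0` the chain jumps to `j` with probability `f j`,
and from `i + 1` it moves to `i` with probability one. -/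
def transition (f : ℕ → ℝ) : ℕ → ℕ → ℝ
  | 0, j => f j
  | i + 1, j => if j = i then 1 else 0

/-- `X` is, under `μ`, a time-homogeneous Markov chain on `ℕ` with transition matrix `p`
(and arbitrary initial law). -/
structure IsMarkovChain {Ω : Type*} [MeasurableSpace Ω] (p : ℕ → ℕ → ℝ)
    (μ : Measure Ω) (X : ℕ → Ω → ℕ) : Prop where
  measurable : ∀ n, Measurable (X n)
  markov : ∀ (n : ℕ) (x : ℕ → ℕ),
    μ.real {ω | ∀ i ≤ n + 1, X i ω = x i} =
      μ.real {ω | ∀ i ≤ n, X i ω = x i} * p (x n) (x (n + 1))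

/-- `ν` is an equilibrium (invariant) probability distribution of `p`. -/
structure IsEquilibrium (p : ℕ → ℕ → ℝ) (ν : ℕ → ℝ) : Prop where
  nonneg : ∀ i, 0 ≤ ν i
  hasSum_one : HasSum ν 1
  invariant : ∀ j, HasSum (fun i => ν i * p i j) (ν j)

/-- `X` is a Markov chain with transition matrix `p`, started in equilibrium. -/
structure IsEquilibriumChain {Ω : Type*} [MeasurableSpace Ω] (p : ℕ → ℕ → ℝ)
    (μ : Measure Ω) (X : ℕ → Ω → ℕ) : Prop where
  isMarkovChain : IsMarkovChain p μ X
  isEquilibrium : IsEquilibrium p (fun i => μ.real {ω | X 0 ω = i})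

/-- The binary series: `Y i = 0` if `X i = 0`, and `Y i = 1` otherwise. -/
def binary {Ω : Type*} (X : ℕ → Ω → ℕ) (i : ℕ) (ω : Ω) : ℝ :=
  if X i ω = 0 then 0 else 1

/-- `F n`: the probability, given that the chain is in state `0` at time `0`, that the number
of steps until the next visit to `0` is at most `n`. -/
def returnCDF {Ω : Type*} [MeasurableSpace Ω] (μ : Measure Ω) (X : ℕ → Ω → ℕ) (n : ℕ) : ℝ :=
  (cond μ {ω | X 0 ω = 0}).real {ω | ∃ k, 1 ≤ k ∧ k ≤ n ∧ X k ω = 0}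

/-- `N n`: the number of visits to `0` at the times `1, …, n`. -/
def visits {Ω : Type*} (X : ℕ → Ω → ℕ) (n : ℕ) (ω : Ω) : ℕ :=
  ((Finset.Icc 1 n).filter fun k => X k ω = 0).card

/-- Weak stationarity of a real time series. -/
structure IsWeaklyStationary {Ω : Type*} [MeasurableSpace Ω] (μ : Measure Ω)
    (Y : ℕ → Ω → ℝ) : Prop where
  memLp : ∀ i, MemLp (Y i) 2 μ
  mean : ∀ i, ∫ ω, Y i ω ∂μ = ∫ ω, Y 0 ω ∂μ
  cov : ∀ i k, covariance (Y i) (Y (i + k)) μ = covariance (Y 0) (Y k) μ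

/-- The autocorrelation function of a weakly stationary time series. -/
def acf {Ω : Type*} [MeasurableSpace Ω] (μ : Measure Ω) (Y : ℕ → Ω → ℝ) (k : ℕ) : ℝ :=
  covariance (Y 0) (Y k) μ / variance (Y 0) μ

/-- Long-range dependence: weakly stationary, and `∑ |ρ k|` over all integers `k` diverges,
where `ρ (-k) = ρ k`. -/
def IsLRD {Ω : Type*} [MeasurableSpace Ω] (μ : Measure Ω) (Y : ℕ → Ω → ℝ) : Prop :=
  IsWeaklyStationary μ Y ∧ ¬ Summable fun k : ℤ => |acf μ Y k.natAbs|

/-- `H` is the Hurst parameter: `ρ k ∼ c k ^ (-a)` for some `c > 0` and `a ∈ (0, 1)` with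
`H = 1 - a / 2`. -/
def HasHurstParameter {Ω : Type*} [MeasurableSpace Ω] (μ : Measure Ω) (Y : ℕ → Ω → ℝ)
    (H : ℝ) : Prop :=
  ∃ a c : ℝ, 0 < a ∧ a < 1 ∧ 0 < c ∧
    IsEquivalent atTop (fun k : ℕ => acf μ Y k) (fun k : ℕ => c * (k : ℝ) ^ (-a)) ∧
    H = 1 - a / 2

end LRDChain

end

/-! Write T for the return time to 0, r n = P(T > n) (`survival`) and u n for the probability of
being back in 0 after n steps. A jump to k gives T = k + 1, so the f k are the differences of r, and
the partial sums of r are explicit: 1/π₀ minus a multiple of a pure power. Thus T has mean 1/π₀ and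
its tail is a discrete derivative of n^(-α).

With R(z) = ∑ r n z^n one has 1 - ∑ f k z^(k+1) = (1 - z) R(z), hence u has generating function
S(z)/(1 - z) with S = 1/R. R has no zero in the closed disc, so Wiener's lemma
(`exists_summable_inverse`) makes the coefficients s of S absolutely summable, with sum 1/R(1) = π₀.
Subtracting π₀/(1 - z) leaves S times the series with coefficients (1 - π₀)(n + 1)^(-α). Since also
n s n → 0, convolution with s only multiplies the asymptotics by π₀, and u n - π₀ ∼ π₀(1 - π₀)
n^(-α) (`exists_renewal`).

All else follows from this rate. In equilibrium the covariance at lag n is π₀(u n - π₀) and the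
variance is π₀(1 - π₀), so ρ(n) ∼ π₀ n^(-α). Starting from 0, the covariances of the visit
indicators are u i (u k - u (i + k)); summing them twice gives Var N n. -/

namespace LRDChain

/-! ### Wiener's lemma for power series, through Gelfand theory -/

section Wiener

theorem summable_smul_pow {A : Type*} [NormedRing A] [NormedAlgebra ℂ A] [CompleteSpace A]
    [NormOneClass A] {S : A} (hS : ‖S‖ ≤ 1) {r : ℕ → ℂ} (hr : Summable fun k => ‖r k‖) :
    Summable fun k => r k • S ^ k := by
  refine Summable.of_norm_bounded hr fun k => ?_
  calc ‖r k • S ^ k‖ ≤ ‖r k‖ * ‖S ^ k‖ := norm_smul_le _ _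
    _ ≤ ‖r k‖ * 1 := by
        gcongr
        exact (norm_pow_le S k).trans (pow_le_one₀ (norm_nonneg _) hS)
    _ = ‖r k‖ := mul_one _

/-- In a commutative Banach algebra, an absolutely convergent power series of a contraction is
invertible as soon as it has no zero in the closed unit disc. -/
theorem isUnit_tsum_smul_pow {A : Type*} [NormedCommRing A] [NormedAlgebra ℂ A]
    [CompleteSpace A] [NormOneClass A] {S : A} (hS : ‖S‖ ≤ 1) {r : ℕ → ℂ}
    (hr : Summable fun k => ‖r k‖) (hz : ∀ z : ℂ, ‖z‖ ≤ 1 → ∑' k, r k * z ^ k ≠ 0) :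
    IsUnit (∑' k, r k • S ^ k) := by
  by_contra h
  -- A nonunit is killed by some character φ, and φ S is then a zero of the power series in the
  -- closed disc.
  obtain ⟨φ, hφ⟩ := WeakDual.CharacterSpace.exists_apply_eq_zero h
  refine hz (φ S) ((AlgHom.norm_apply_le_self φ S).trans hS) ?_
  have h1 := (summable_smul_pow hS hr).hasSum.map φ (map_continuous φ)
  rw [hφ] at h1
  convert h1.tsum_eq using 3 with k
  simp

/-- The noncommutative version of `isUnit_tsum_smul_pow`. -/
theorem exists_mul_eq_one_tsum_smul_pow {A : Type*} [NormedRing A] [NormedAlgebra ℂ A]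
    [CompleteSpace A] [NormOneClass A] {S : A} (hS : ‖S‖ ≤ 1) {r : ℕ → ℂ}
    (hr : Summable fun k => ‖r k‖) (hz : ∀ z : ℂ, ‖z‖ ≤ 1 → ∑' k, r k * z ^ k ≠ 0) :
    ∃ Q : A, (∑' k, r k • S ^ k) * Q = 1 := by
  -- The closed subalgebra generated by S is commutative and contains the series, so the inverse is
  -- found there.
  let _ : NormedCommRing (Algebra.elemental ℂ S) :=
    { (inferInstance : NormedRing (Algebra.elemental ℂ S)) with
      mul_comm := fun x y => mul_comm x y }
  have _ : NormOneClass (Algebra.elemental ℂ S) := ⟨norm_one (α := A)⟩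
  let S' : Algebra.elemental ℂ S := ⟨S, Algebra.elemental.self_mem ℂ S⟩
  have hS' : ‖S'‖ ≤ 1 := hS
  obtain ⟨Q, hQ⟩ := (isUnit_tsum_smul_pow hS' hr hz).exists_right_inv
  refine ⟨Q, ?_⟩
  have h1 := (summable_smul_pow hS' hr).hasSum.map (Algebra.elemental ℂ S).val
    continuous_subtype_val
  have h2 : ∑' k, r k • S ^ k = ((∑' k, r k • S' ^ k : Algebra.elemental ℂ S) : A) := by
    exact h1.tsum_eq
  rw [h2]
  exact congrArg (Subtype.val) hQ

/-- The sequence `0, a 0, a 1, …`. -/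
def shiftSeq (a : ℕ → ℂ) (n : ℕ) : ℂ := if n = 0 then 0 else a (n - 1)

theorem summable_norm_lp_one (a : lp (fun _ : ℕ => ℂ) 1) : Summable fun n => ‖a n‖ := by
  simpa using (memℓp_gen_iff (by simp)).1 (lp.memℓp a)

theorem hasSum_norm_lp_one (a : lp (fun _ : ℕ => ℂ) 1) : HasSum (fun n => ‖a n‖) ‖a‖ := by
  simpa using lp.hasSum_norm (by simp) a

theorem hasSum_norm_shiftSeq {a : ℕ → ℂ} {x : ℝ} (ha : HasSum (fun n => ‖a n‖) x) :
    HasSum (fun n => ‖shiftSeq a n‖) x := by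
  rw [← hasSum_nat_add_iff' 1]
  simpa [shiftSeq] using ha

/-- The right shift of a sequence in `ℓ¹`. -/
def shiftLp (a : lp (fun _ : ℕ => ℂ) 1) : lp (fun _ : ℕ => ℂ) 1 :=
  ⟨shiftSeq a, memℓp_gen (by
    simpa using (hasSum_norm_shiftSeq (hasSum_norm_lp_one a)).summable)⟩

theorem shiftLp_apply (a : lp (fun _ : ℕ => ℂ) 1) (n : ℕ) :
    shiftLp a n = if n = 0 then 0 else a (n - 1) := rfl

theorem norm_shiftLp (a : lp (fun _ : ℕ => ℂ) 1) : ‖shiftLp a‖ = ‖a‖ :=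
  (hasSum_norm_lp_one (shiftLp a)).unique (hasSum_norm_shiftSeq (hasSum_norm_lp_one a))

theorem shiftLp_add (a b : lp (fun _ : ℕ => ℂ) 1) : shiftLp (a + b) = shiftLp a + shiftLp b := by
  apply lp.ext
  funext n
  rw [lp.coeFn_add, Pi.add_apply]
  simp only [shiftLp_apply, lp.coeFn_add, Pi.add_apply]
  split_ifs <;> simp

theorem shiftLp_smul (c : ℂ) (a : lp (fun _ : ℕ => ℂ) 1) : shiftLp (c • a) = c • shiftLp a := by
  apply lp.ext
  funext n
  rw [lp.coeFn_smul, Pi.smul_apply]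
  simp only [shiftLp_apply, lp.coeFn_smul, Pi.smul_apply]
  split_ifs <;> simp

/-- The right shift on `ℓ¹`, as a continuous linear map. -/
noncomputable def rightShift : lp (fun _ : ℕ => ℂ) 1 →L[ℂ] lp (fun _ : ℕ => ℂ) 1 :=
  LinearMap.mkContinuous
    { toFun := shiftLp
      map_add' := shiftLp_add
      map_smul' := shiftLp_smul } 1 (fun a => by
    rw [one_mul]
    exact (norm_shiftLp a).le)

theorem norm_rightShift_le : ‖rightShift‖ ≤ 1 :=
  LinearMap.mkContinuous_norm_le _ zero_le_one _

theorem rightShift_apply (a : lp (fun _ : ℕ => ℂ) 1) (n : ℕ) :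
    rightShift a n = if n = 0 then 0 else a (n - 1) := rfl

theorem rightShift_pow_apply (k : ℕ) (a : lp (fun _ : ℕ => ℂ) 1) (n : ℕ) :
    (rightShift ^ k) a n = if k ≤ n then a (n - k) else 0 := by
  induction k generalizing n with
  | zero => simp
  | succ k ih =>
    rw [pow_succ', mul_apply_eq_comp, rightShift_apply]
    rcases n with _ | n
    · simp
    · simpa only [Nat.succ_ne_zero, if_false, Nat.add_sub_cancel, Nat.add_le_add_iff_right,
        Nat.add_sub_add_right] using ih n

theorem tsum_smul_rightShift_apply {r : ℕ → ℂ} (hr : Summable fun k => ‖r k‖)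
    [NormOneClass (lp (fun _ : ℕ => ℂ) 1 →L[ℂ] lp (fun _ : ℕ => ℂ) 1)]
    (a : lp (fun _ : ℕ => ℂ) 1) (n : ℕ) :
    (∑' k, r k • rightShift ^ k : lp (fun _ : ℕ => ℂ) 1 →L[ℂ] lp (fun _ : ℕ => ℂ) 1) a n =
      ∑ k ∈ Finset.range (n + 1), r k * a (n - k) := by
  have h1 := (summable_smul_pow norm_rightShift_le hr).hasSum
  have h2 := (h1.mapL (ContinuousLinearMap.apply ℂ _ a)).mapL
    (lp.evalCLM ℂ (fun _ : ℕ => ℂ) 1 n)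
  have h3 : HasSum (fun k => r k * if k ≤ n then a (n - k) else 0)
      ((∑' k, r k • rightShift ^ k :
        lp (fun _ : ℕ => ℂ) 1 →L[ℂ] lp (fun _ : ℕ => ℂ) 1) a n) := by
    simp_rw [← rightShift_pow_apply]
    exact h2
  rw [← h3.tsum_eq, tsum_eq_sum (s := Finset.range (n + 1))]
  · refine Finset.sum_congr rfl fun k hk => ?_
    rw [if_pos (Nat.lt_succ_iff.1 (Finset.mem_range.1 hk))]
  · intro k hk
    rw [if_neg (fun h => hk (Finset.mem_range.2 (Nat.lt_succ_iff.2 h))), mul_zero]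

/-- **Wiener's lemma** for power series: an absolutely summable real power series without zeros in
the closed unit disc has an absolutely summable inverse. -/
theorem exists_summable_inverse {r : ℕ → ℝ} (hr : Summable fun k => |r k|)
    (hz : ∀ z : ℂ, ‖z‖ ≤ 1 → ∑' k, (r k : ℂ) * z ^ k ≠ 0) :
    ∃ s : ℕ → ℝ, (Summable fun k => |s k|) ∧ PowerSeries.mk r * PowerSeries.mk s = 1 := by
  have hr' : Summable fun k => ‖(r k : ℂ)‖ := by simpa using hr
  set e : lp (fun _ : ℕ => ℂ) 1 := lp.single 1 0 1 with he
  have he0 : e 0 = 1 := by simp [he]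
  have hen : ∀ n, n ≠ 0 → e n = 0 := fun n hn => by
    rw [he, lp.single_apply_ne _ _ _ hn]
  have _ : Nontrivial (lp (fun _ : ℕ => ℂ) 1) :=
    ⟨e, 0, fun h => by simp [h] at he0⟩
  obtain ⟨Q, hQ⟩ := exists_mul_eq_one_tsum_smul_pow norm_rightShift_le hr' hz
  -- The series in the shift acts on ℓ¹ as convolution with r, so `Q e` is a convolution inverse of
  -- r. As r is real, the real parts of `Q e` form one too.
  have hconv : ∀ n, ∑ k ∈ Finset.range (n + 1), (r k : ℂ) * Q e (n - k) = e n := fun n => by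
    rw [← tsum_smul_rightShift_apply hr', ← mul_apply_eq_comp, hQ,
      one_apply_eq_self]
  refine ⟨fun n => (Q e n).re, ?_, ?_⟩
  · exact Summable.of_nonneg_of_le (fun n => abs_nonneg _) (fun n => Complex.abs_re_le_norm _)
      (summable_norm_lp_one (Q e))
  · ext n
    rw [PowerSeries.coeff_mul, Finset.Nat.sum_antidiagonal_eq_sum_range_succ_mk,
      PowerSeries.coeff_one]
    have h := congrArg Complex.re (hconv n)
    simp only [Complex.re_sum, Complex.re_ofReal_mul] at h
    simp only [PowerSeries.coeff_mk]
    rw [h]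
    split_ifs with h0
    · simp [h0, he0]
    · simp [hen n h0]

end Wiener

/-! ### Regularly varying sequences: shifts, differences, sums -/

section PowerAsymptotics

open Topology

theorem isEquivalent_of_tendsto_div_rpow {a : ℕ → ℝ} {β C : ℝ} (hC : C ≠ 0)
    (h : Tendsto (fun n : ℕ => a n / (n : ℝ) ^ β) atTop (𝓝 C)) :
    IsEquivalent atTop a fun n : ℕ => C * (n : ℝ) ^ β := by
  have hpos : ∀ᶠ n : ℕ in atTop, C * (n : ℝ) ^ β ≠ 0 := by
    filter_upwards [eventually_gt_atTop 0] with n hn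
    have : (0 : ℝ) < n := by exact_mod_cast hn
    positivity
  rw [isEquivalent_iff_tendsto_one hpos]
  have h1 := h.div_const C
  rw [div_self hC] at h1
  refine h1.congr fun n => ?_
  simp only [Pi.div_apply]
  rw [div_div, mul_comm]

theorem tendsto_natCast_sub_div (k : ℕ) :
    Tendsto (fun n : ℕ => ((n - k : ℕ) : ℝ) / n) atTop (𝓝 1) := by
  have h1 : Tendsto (fun n : ℕ => 1 - (k : ℝ) / n) atTop (𝓝 (1 - 0)) :=
    tendsto_const_nhds.sub (tendsto_const_div_atTop_nhds_zero_nat _)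
  rw [sub_zero] at h1
  refine h1.congr' ?_
  filter_upwards [eventually_gt_atTop 0, eventually_ge_atTop k] with n hn hk
  have : (n : ℝ) ≠ 0 := by exact_mod_cast hn.ne'
  rw [Nat.cast_sub hk, sub_div, div_self this]

theorem tendsto_sub_rpow_div_rpow (k : ℕ) (β : ℝ) :
    Tendsto (fun n : ℕ => ((n - k : ℕ) : ℝ) ^ β / (n : ℝ) ^ β) atTop (𝓝 1) := by
  have h := (tendsto_natCast_sub_div k).rpow_const (p := β) (Or.inl one_ne_zero)
  rw [Real.one_rpow] at h
  exact h.congr fun n => Real.div_rpow (Nat.cast_nonneg _) (Nat.cast_nonneg _) _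

theorem tendsto_succ_rpow_div_rpow (β : ℝ) :
    Tendsto (fun n : ℕ => ((n : ℝ) + 1) ^ β / (n : ℝ) ^ β) atTop (𝓝 1) := by
  have h := ((tendsto_sub_rpow_div_rpow 1 β).comp (tendsto_add_atTop_nat 1)).inv₀ one_ne_zero
  rw [inv_one] at h
  refine h.congr fun n => ?_
  simp

theorem tendsto_div_rpow_succ {a : ℕ → ℝ} {β C : ℝ}
    (h : Tendsto (fun n : ℕ => a n / (n : ℝ) ^ β) atTop (𝓝 C)) :
    Tendsto (fun n : ℕ => a (n + 1) / (n : ℝ) ^ β) atTop (𝓝 C) := by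
  have h1 := (h.comp (tendsto_add_atTop_nat 1)).mul (tendsto_succ_rpow_div_rpow β)
  rw [mul_one] at h1
  refine h1.congr fun n => ?_
  have : ((n : ℝ) + 1) ^ β ≠ 0 := by positivity
  simp only [Function.comp_apply, Nat.cast_add, Nat.cast_one]
  field_simp

theorem tendsto_zero_of_div_rpow_neg {a : ℕ → ℝ} {α C : ℝ} (hα : 0 < α)
    (h : Tendsto (fun n : ℕ => a n / (n : ℝ) ^ (-α)) atTop (𝓝 C)) :
    Tendsto a atTop (𝓝 0) := by
  have h1 := h.mul ((tendsto_rpow_neg_atTop hα).comp tendsto_natCast_atTop_atTop)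
  rw [mul_zero] at h1
  refine h1.congr' ?_
  filter_upwards [eventually_gt_atTop 0] with n hn
  have : (0 : ℝ) < n := by exact_mod_cast hn
  have : (n : ℝ) ^ (-α) ≠ 0 := by positivity
  simp only [Function.comp_apply]
  field_simp

/-- After factoring out n^γ this is the difference quotient of x^γ at 1 with increment 1/n. -/
theorem tendsto_rpow_succ_sub_div (γ : ℝ) :
    Tendsto (fun n : ℕ => (((n : ℝ) + 1) ^ γ - (n : ℝ) ^ γ) / (n : ℝ) ^ (γ - 1))
      atTop (𝓝 γ) := by
  have h1 : HasDerivAt (fun x : ℝ => x ^ γ) (γ * (1 : ℝ) ^ (γ - 1)) 1 :=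
    Real.hasDerivAt_rpow_const (Or.inl one_ne_zero)
  rw [Real.one_rpow, mul_one, hasDerivAt_iff_tendsto_slope_zero] at h1
  have h2 : Tendsto (fun n : ℕ => ((n : ℝ))⁻¹) atTop (𝓝[≠] 0) := by
    refine tendsto_nhdsWithin_iff.2 ⟨tendsto_inv_atTop_nhds_zero_nat, ?_⟩
    filter_upwards [eventually_gt_atTop 0] with n hn
    have : (0 : ℝ) < n := by exact_mod_cast hn
    exact inv_ne_zero this.ne'
  refine (h1.comp h2).congr' ?_
  filter_upwards [eventually_gt_atTop 0] with n hn
  have hn' : (0 : ℝ) < n := by exact_mod_cast hn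
  simp only [Function.comp_apply, smul_eq_mul, inv_inv, Real.one_rpow]
  have h3 : (n : ℝ) + 1 = n * (1 + (n : ℝ)⁻¹) := by field_simp
  rw [h3, Real.mul_rpow hn'.le (by positivity), Real.rpow_sub_one hn'.ne']
  have : (n : ℝ) ^ γ ≠ 0 := by positivity
  field_simp

/-- A Stolz–Cesàro argument: a is compared with the increments g of n^(β+1), whose sums telescope.
The difference is o(g), and this survives summation because β > -1 makes ∑ g diverge. -/
theorem tendsto_sum_div_rpow {a : ℕ → ℝ} {β C : ℝ} (hβ : -1 < β)
    (h : Tendsto (fun n : ℕ => a n / (n : ℝ) ^ β) atTop (𝓝 C)) :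
    Tendsto (fun n : ℕ => (∑ i ∈ Finset.range n, a i) / (n : ℝ) ^ (β + 1)) atTop
      (𝓝 (C / (β + 1))) := by
  have hβ1 : 0 < β + 1 := by linarith
  set g : ℕ → ℝ := fun i => ((i : ℝ) + 1) ^ (β + 1) - (i : ℝ) ^ (β + 1) with hg
  have hgpos : ∀ i, 0 < g i := fun i => by
    have : (i : ℝ) ^ (β + 1) < ((i : ℝ) + 1) ^ (β + 1) :=
      Real.rpow_lt_rpow (Nat.cast_nonneg _) (by linarith) hβ1
    simp only [hg]; linarith
  have hgsum : ∀ n, ∑ i ∈ Finset.range n, g i = (n : ℝ) ^ (β + 1) := fun n => by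
    have := Finset.sum_range_sub (fun i : ℕ => (i : ℝ) ^ (β + 1)) n
    simp only [Nat.cast_add, Nat.cast_one, Nat.cast_zero, Real.zero_rpow hβ1.ne', sub_zero] at this
    exact this
  have hgdiv : Tendsto (fun n : ℕ => g n / (n : ℝ) ^ β) atTop (𝓝 (β + 1)) := by
    simpa using tendsto_rpow_succ_sub_div (β + 1)
  have hlo : (fun n => a n - C / (β + 1) * g n) =o[atTop] g := by
    rw [isLittleO_iff_tendsto (fun n hn => absurd hn (hgpos n).ne')]
    have h1 := (h.div hgdiv hβ1.ne').sub_const (C / (β + 1))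
    rw [sub_self] at h1
    refine h1.congr' ?_
    filter_upwards [eventually_gt_atTop 0] with n hn
    have hn' : (0 : ℝ) < n := by exact_mod_cast hn
    have h2 : (n : ℝ) ^ β ≠ 0 := by positivity
    have h3 := (hgpos n).ne'
    simp only [Pi.div_apply]
    field_simp
  have hsum := hlo.sum_range (fun i => (hgpos i).le) (by
    simp_rw [hgsum]
    exact (tendsto_rpow_atTop hβ1).comp tendsto_natCast_atTop_atTop)
  simp_rw [hgsum, Finset.sum_sub_distrib, ← Finset.mul_sum, hgsum] at hsum
  have h4 := (hsum.tendsto_div_nhds_zero).add_const (C / (β + 1))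
  rw [zero_add] at h4
  refine h4.congr' ?_
  filter_upwards [eventually_gt_atTop 0] with n hn
  have hn' : (0 : ℝ) < n := by exact_mod_cast hn
  have h2 : (n : ℝ) ^ (β + 1) ≠ 0 := by positivity
  field_simp
  ring

theorem sum_rpow_le {α : ℝ} (hα : α < 1) :
    ∃ K, 0 < K ∧ ∀ n : ℕ, ∑ i ∈ Finset.range n, ((i : ℝ) + 1) ^ (-α) ≤ K * (n : ℝ) ^ (1 - α) := by
  have h1 : Tendsto (fun n : ℕ => (∑ i ∈ Finset.range n, ((i : ℝ) + 1) ^ (-α)) /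
      (n : ℝ) ^ (-α + 1)) atTop (𝓝 (1 / (-α + 1))) :=
    tendsto_sum_div_rpow (by linarith) (tendsto_succ_rpow_div_rpow (-α))
  obtain ⟨K, hK⟩ := h1.bddAbove_range
  refine ⟨max K 1, by positivity, fun n => ?_⟩
  rcases Nat.eq_zero_or_pos n with rfl | hn
  · simp [Real.zero_rpow (by linarith : (1 - α) ≠ 0)]
  · have hn' : (0 : ℝ) < n := by exact_mod_cast hn
    have h2 := hK ⟨n, rfl⟩
    simp only [neg_add_eq_sub] at h2
    rw [div_le_iff₀ (by positivity)] at h2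
    exact h2.trans (by gcongr; exact le_max_left _ _)

/-- Convolving a null sequence with `n ^ (-α)`. -/
theorem tendsto_sum_mul_rpow_div_zero {e : ℕ → ℝ} {α : ℝ} (hα₀ : 0 < α) (hα : α < 1)
    (he : Tendsto e atTop (𝓝 0)) :
    Tendsto (fun n : ℕ => (∑ k ∈ Finset.range n, |e k| * ((n - k : ℕ) : ℝ) ^ (-α)) /
      (n : ℝ) ^ (1 - α)) atTop (𝓝 0) := by
  obtain ⟨K, hK0, hK⟩ := sum_rpow_le hα
  rw [Metric.tendsto_atTop]
  intro ε hε
  -- The terms k < N contribute at most the constant M, as the powers are at most 1; the others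
  -- contribute at most ε/(2K) times the full sum of powers, which is at most K n^(1-α).
  obtain ⟨N, hN⟩ := (Metric.tendsto_atTop.1 he) (ε / (2 * K)) (by positivity)
  set M := ∑ k ∈ Finset.range N, |e k| with hM
  have hM0 : 0 ≤ M := Finset.sum_nonneg fun _ _ => abs_nonneg _
  have hsmall : Tendsto (fun n : ℕ => M / (n : ℝ) ^ (1 - α)) atTop (𝓝 0) :=
    tendsto_const_nhds.div_atTop
      ((tendsto_rpow_atTop (by linarith)).comp tendsto_natCast_atTop_atTop)
  have hev := (hsmall.eventually_lt_const (half_pos hε)).and (eventually_gt_atTop 0)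
  obtain ⟨N', hN'⟩ := eventually_atTop.1 hev
  refine ⟨N', fun n hn => ?_⟩
  obtain ⟨h1, h2⟩ := hN' n hn
  have hn' : (0 : ℝ) < n := by exact_mod_cast h2
  have hpow : 0 < (n : ℝ) ^ (1 - α) := by positivity
  rw [Real.dist_eq, sub_zero, abs_of_nonneg (by positivity), div_lt_iff₀ hpow]
  rw [div_lt_iff₀ hpow] at h1
  have hterm : ∀ k ∈ Finset.range n, |e k| * ((n - k : ℕ) : ℝ) ^ (-α) ≤
      (if k < N then |e k| else 0) + ε / (2 * K) * ((n - k : ℕ) : ℝ) ^ (-α) := by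
    intro k hk
    have hk1 : (1 : ℝ) ≤ ((n - k : ℕ) : ℝ) := by
      exact_mod_cast Nat.sub_pos_of_lt (Finset.mem_range.1 hk)
    have hp1 : ((n - k : ℕ) : ℝ) ^ (-α) ≤ 1 :=
      Real.rpow_le_one_of_one_le_of_nonpos hk1 (by linarith)
    have hp0 : 0 ≤ ((n - k : ℕ) : ℝ) ^ (-α) := by positivity
    split_ifs with hkN
    · have := mul_le_of_le_one_right (abs_nonneg (e k)) hp1
      have h3 : 0 ≤ ε / (2 * K) * ((n - k : ℕ) : ℝ) ^ (-α) := by positivity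
      linarith
    · have := hN k (not_lt.1 hkN)
      rw [Real.dist_eq, sub_zero] at this
      rw [zero_add]
      gcongr
  refine (Finset.sum_le_sum hterm).trans_lt ?_
  rw [Finset.sum_add_distrib, ← Finset.mul_sum]
  have hA : ∑ k ∈ Finset.range n, (if k < N then |e k| else 0) ≤ M := by
    rw [← Finset.sum_filter]
    refine Finset.sum_le_sum_of_subset_of_nonneg (fun k hk => ?_) fun _ _ _ => abs_nonneg _
    exact Finset.mem_range.2 (Finset.mem_filter.1 hk).2
  have hB : ∑ k ∈ Finset.range n, ((n - k : ℕ) : ℝ) ^ (-α) ≤ K * (n : ℝ) ^ (1 - α) := by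
    rw [← Finset.sum_range_reflect]
    refine le_of_eq_of_le (Finset.sum_congr rfl fun k hk => ?_) (hK n)
    have hk' := Finset.mem_range.1 hk
    rw [show n - (n - 1 - k) = k + 1 by omega]
    push_cast; rfl
  have hC : ε / (2 * K) * ∑ k ∈ Finset.range n, ((n - k : ℕ) : ℝ) ^ (-α) ≤
      ε / 2 * (n : ℝ) ^ (1 - α) := by
    calc _ ≤ ε / (2 * K) * (K * (n : ℝ) ^ (1 - α)) := by gcongr
      _ = _ := by field_simp
  linarith

end PowerAsymptotics

/-! ### Convolution with summable sequences -/

section Convolution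

open Topology

/-- Dominated convergence in k: e is bounded, so a multiple of |s k| dominates. -/
theorem tendsto_sum_mul_sub {s e : ℕ → ℝ} {L : ℝ} (hs : Summable fun k => |s k|)
    (he : Tendsto e atTop (𝓝 L)) :
    Tendsto (fun n : ℕ => ∑ k ∈ Finset.range (n + 1), s k * e (n - k)) atTop
      (𝓝 ((∑' k, s k) * L)) := by
  obtain ⟨M, hM⟩ := he.abs.bddAbove_range
  have hM' : ∀ n, |e n| ≤ M := fun n => hM ⟨n, rfl⟩
  have h := tendsto_tsum_of_dominated_convergence (𝓕 := atTop)
    (f := fun n k => if k ≤ n then s k * e (n - k) else 0) (g := fun k => s k * L)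
    (hs.mul_right M) (fun k => ?_) (Eventually.of_forall fun n k => ?_)
  · rw [tsum_mul_right] at h
    refine h.congr fun n => ?_
    rw [tsum_eq_sum (s := Finset.range (n + 1))]
    · refine Finset.sum_congr rfl fun k hk => ?_
      rw [if_pos (Nat.lt_succ_iff.1 (Finset.mem_range.1 hk))]
    · intro k hk
      rw [if_neg fun h => hk (Finset.mem_range.2 (Nat.lt_succ_iff.2 h))]
  · refine ((he.comp (tendsto_sub_atTop_nat k)).const_mul (s k)).congr' ?_
    filter_upwards [eventually_ge_atTop k] with n hn
    simp [hn]
  · split_ifs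
    · rw [norm_mul]
      exact mul_le_mul_of_nonneg_left (hM' _) (abs_nonneg _)
    · rw [norm_zero]
      exact mul_nonneg (abs_nonneg _) ((abs_nonneg _).trans (hM' 0))

theorem coeff_mk_mul (a : ℕ → ℝ) (p : PowerSeries ℝ) (n : ℕ) :
    PowerSeries.coeff n (PowerSeries.mk a * p) =
      ∑ k ∈ Finset.range (n + 1), a k * PowerSeries.coeff (n - k) p := by
  rw [PowerSeries.coeff_mul, Finset.Nat.sum_antidiagonal_eq_sum_range_succ_mk]
  simp

theorem coeff_X_mul_derivative (p : PowerSeries ℝ) (n : ℕ) :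
    PowerSeries.coeff n (PowerSeries.X * PowerSeries.derivative ℝ p) =
      n * PowerSeries.coeff n p := by
  rcases n with _ | n
  · simp
  · rw [PowerSeries.coeff_succ_X_mul, PowerSeries.coeff_derivative, mul_comm]
    push_cast; rfl

/-- If `n * r n → 0`, then the same holds for the absolutely summable inverse of `r`. -/
theorem tendsto_mul_inverse_zero {r s : ℕ → ℝ} (hs : Summable fun k => |s k|)
    (hrs : PowerSeries.mk r * PowerSeries.mk s = 1)
    (hr : Tendsto (fun n : ℕ => n * r n) atTop (𝓝 0)) :
    Tendsto (fun n : ℕ => n * s n) atTop (𝓝 0) := by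
  -- Differentiating r s = 1 gives z s' = -s² z r', so n s n is, up to sign, the null sequence n r n
  -- convolved twice with s.
  have hid : PowerSeries.X * PowerSeries.derivative ℝ (PowerSeries.mk s) =
      -(PowerSeries.mk s * (PowerSeries.mk s *
        (PowerSeries.X * PowerSeries.derivative ℝ (PowerSeries.mk r)))) := by
    have h1 := congrArg (PowerSeries.derivative ℝ) hrs
    rw [Derivation.leibniz, Derivation.map_one_eq_zero, smul_eq_mul, smul_eq_mul] at h1
    linear_combination (-(PowerSeries.X * PowerSeries.derivative ℝ (PowerSeries.mk s))) * hrs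
      + PowerSeries.X * PowerSeries.mk s * h1
  have h1 : Tendsto (fun n : ℕ => PowerSeries.coeff n
      (PowerSeries.X * PowerSeries.derivative ℝ (PowerSeries.mk r))) atTop (𝓝 0) := by
    simpa only [coeff_X_mul_derivative, PowerSeries.coeff_mk] using hr
  have h2 := tendsto_sum_mul_sub hs h1
  simp_rw [← coeff_mk_mul, mul_zero] at h2
  have h3 := (tendsto_sum_mul_sub hs h2).neg
  simp_rw [← coeff_mk_mul, mul_zero, neg_zero, ← map_neg, ← hid, coeff_X_mul_derivative,
    PowerSeries.coeff_mk] at h3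
  exact h3

/-- Convolving an absolutely summable sequence `s` with `n ^ (-α)`. -/
theorem tendsto_sum_mul_rpow_div {s : ℕ → ℝ} {α : ℝ} (hα₀ : 0 < α) (hα : α < 1)
    (hs : Summable fun k => |s k|) (hs' : Tendsto (fun n : ℕ => n * s n) atTop (𝓝 0)) :
    Tendsto (fun n : ℕ => (∑ k ∈ Finset.range n, s k * ((n - k : ℕ) : ℝ) ^ (-α)) /
      (n : ℝ) ^ (-α)) atTop (𝓝 (∑' k, s k)) := by
  -- The sum is split at k = n/2. Below, the ratio of powers is at most 2^α and dominated
  -- convergence yields the limit.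
  have hmain := tendsto_tsum_of_dominated_convergence (𝓕 := atTop)
    (f := fun (n k : ℕ) => if 2 * k < n then
      s k * (((n - k : ℕ) : ℝ) ^ (-α) / (n : ℝ) ^ (-α)) else 0) (g := s)
    (hs.mul_right (2 ^ α)) (fun k => ?_) ?_
  rotate_left
  · have h1 := (tendsto_sub_rpow_div_rpow k (-α)).const_mul (s k)
    rw [mul_one] at h1
    refine h1.congr' ?_
    filter_upwards [eventually_gt_atTop (2 * k)] with n hn
    simp [hn]
  · filter_upwards [eventually_gt_atTop 0] with n hn k
    have hn' : (0 : ℝ) < n := by exact_mod_cast hn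
    split_ifs with hk
    · rw [norm_mul, Real.norm_eq_abs, Real.norm_eq_abs]
      gcongr
      rw [abs_of_nonneg (by positivity), div_le_iff₀ (by positivity)]
      have h2 : (n : ℝ) / 2 ≤ ((n - k : ℕ) : ℝ) := by
        rw [Nat.cast_sub (by omega)]
        have : (2 : ℝ) * k < n := by exact_mod_cast hk
        linarith
      calc ((n - k : ℕ) : ℝ) ^ (-α) ≤ ((n : ℝ) / 2) ^ (-α) :=
            Real.rpow_le_rpow_of_nonpos (by positivity) h2 (by linarith)
        _ = 2 ^ α * (n : ℝ) ^ (-α) := by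
            rw [Real.div_rpow hn'.le (by norm_num), Real.rpow_neg (by norm_num : (0 : ℝ) ≤ 2)]
            field_simp
    · rw [norm_zero]; positivity
  -- For k ≥ n/2, |s k| ≤ 2 k |s k| / n; the factor 1/n turns the o(n^(1-α)) bound for null
  -- sequences into the required o(n^(-α)).
  have hrem : Tendsto (fun n : ℕ => (∑ k ∈ Finset.range n, if 2 * k < n then 0 else
      s k * (((n - k : ℕ) : ℝ) ^ (-α) / (n : ℝ) ^ (-α)))) atTop (𝓝 0) := by
    have h1 := (tendsto_sum_mul_rpow_div_zero hα₀ hα hs').const_mul 2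
    rw [mul_zero] at h1
    refine squeeze_zero_norm' ?_ h1
    filter_upwards [eventually_gt_atTop 0] with n hn
    have hn' : (0 : ℝ) < n := by exact_mod_cast hn
    refine (norm_sum_le _ _).trans ?_
    rw [Finset.sum_div, Finset.mul_sum]
    refine Finset.sum_le_sum fun k _ => ?_
    have hp : 0 ≤ ((n - k : ℕ) : ℝ) ^ (-α) := by positivity
    have hpow : (n : ℝ) ^ (1 - α) = n * (n : ℝ) ^ (-α) := by
      rw [sub_eq_add_neg, Real.rpow_add hn', Real.rpow_one]
    have hnp : 0 < (n : ℝ) ^ (-α) := by positivity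
    split_ifs with hk
    · rw [norm_zero]; positivity
    · have hk' : (n : ℝ) ≤ 2 * k := by exact_mod_cast not_lt.1 hk
      rw [norm_mul, Real.norm_eq_abs, Real.norm_eq_abs, hpow,
        abs_of_nonneg (by positivity : 0 ≤ ((n - k : ℕ) : ℝ) ^ (-α) / (n : ℝ) ^ (-α)), abs_mul,
        Nat.abs_cast]
      have h3 : |s k| ≤ 2 * (k * |s k| / n) := by
        rw [← mul_div_assoc, le_div_iff₀ hn']
        nlinarith [abs_nonneg (s k)]
      calc |s k| * (((n - k : ℕ) : ℝ) ^ (-α) / (n : ℝ) ^ (-α))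
          ≤ 2 * (k * |s k| / n) * (((n - k : ℕ) : ℝ) ^ (-α) / (n : ℝ) ^ (-α)) := by gcongr
        _ = _ := by field_simp
  have hsum := hmain.add hrem
  rw [add_zero] at hsum
  refine hsum.congr fun n => ?_
  rw [tsum_eq_sum (s := Finset.range n), ← Finset.sum_add_distrib, Finset.sum_div]
  · refine Finset.sum_congr rfl fun k _ => ?_
    split_ifs <;> ring
  · intro k hk
    rw [Finset.mem_range, not_lt] at hk
    rw [if_neg (by omega)]

end Convolution

/-! ### Growth of the variance from the rate of u n - p -/

section VarianceGrowth

open Topology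

theorem exists_abs_succ_le_rpow {d : ℕ → ℝ} {α D : ℝ}
    (hd : Tendsto (fun n : ℕ => d n / (n : ℝ) ^ (-α)) atTop (𝓝 D)) :
    ∃ K, 0 ≤ K ∧ ∀ n : ℕ, 0 < n → |d n| ≤ K * (n : ℝ) ^ (-α) := by
  obtain ⟨K, hK⟩ := hd.abs.bddAbove_range
  refine ⟨K, (abs_nonneg _).trans (hK ⟨0, rfl⟩), fun n hn => ?_⟩
  have hn' : (0 : ℝ) < n := by exact_mod_cast hn
  have h := hK ⟨n, rfl⟩
  have hp : 0 < (n : ℝ) ^ (-α) := by positivity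
  simp only [abs_div, abs_of_pos hp] at h
  rwa [div_le_iff₀ hp] at h

/-- Expanding, the terms linear in d give p D (1/(1 - α) - 1) n^(1-α), and the quadratic ones are
o(n^(1-α)) because d tends to 0. -/
theorem tendsto_increment_div_rpow {d : ℕ → ℝ} {α D p : ℝ} (hα₀ : 0 < α) (hα : α < 1)
    (hd : Tendsto (fun n : ℕ => d n / (n : ℝ) ^ (-α)) atTop (𝓝 D)) :
    Tendsto (fun n : ℕ => (∑ i ∈ Finset.range n,
      (p + d (i + 1)) * ((p + d (n - i)) - (p + d (n + 1)))) / (n : ℝ) ^ (1 - α)) atTop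
      (𝓝 (p * D * α / (1 - α))) := by
  have hd0 := tendsto_zero_of_div_rpow_neg hα₀ hd
  have hd1 := tendsto_div_rpow_succ hd
  have hd01 := hd0.comp (tendsto_add_atTop_nat 1)
  have hS := tendsto_sum_div_rpow (by linarith) hd1
  rw [neg_add_eq_sub] at hS
  obtain ⟨K, hK0, hK⟩ := exists_abs_succ_le_rpow hd
  have hconv : Tendsto (fun n : ℕ => (∑ i ∈ Finset.range n, d (i + 1) * d (n - i)) /
      (n : ℝ) ^ (1 - α)) atTop (𝓝 0) := by
    have h1 := (tendsto_sum_mul_rpow_div_zero hα₀ hα hd01).const_mul K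
    rw [mul_zero] at h1
    refine squeeze_zero_norm (fun n => ?_) h1
    have hp : 0 ≤ (n : ℝ) ^ (1 - α) := by positivity
    rw [norm_div, Real.norm_of_nonneg hp, ← mul_div_assoc]
    gcongr
    refine (norm_sum_le _ _).trans ?_
    rw [Finset.mul_sum]
    refine Finset.sum_le_sum fun k hk => ?_
    have := hK (n - k) (Nat.sub_pos_of_lt (Finset.mem_range.1 hk))
    rw [norm_mul, Real.norm_eq_abs, Real.norm_eq_abs, Function.comp_apply]
    calc |d (k + 1)| * |d (n - k)| ≤ |d (k + 1)| * (K * ((n - k : ℕ) : ℝ) ^ (-α)) := by gcongr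
      _ = _ := by ring
  have hall := (((hS.const_mul p).sub (hd1.const_mul p)).add hconv).sub (hd01.mul hS)
  have hlim : p * (D / (1 - α)) - p * D + 0 - 0 * (D / (1 - α)) = p * D * α / (1 - α) := by
    have : 1 - α ≠ 0 := by linarith
    field_simp
    ring
  rw [hlim] at hall
  refine hall.congr' ?_
  filter_upwards [eventually_gt_atTop 0] with n hn
  have hn' : (0 : ℝ) < n := by exact_mod_cast hn
  have hpow : (n : ℝ) ^ (1 - α) = n * (n : ℝ) ^ (-α) := by
    rw [sub_eq_add_neg, Real.rpow_add hn', Real.rpow_one]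
  have hnp : 0 < (n : ℝ) ^ (-α) := by positivity
  have hrefl : ∑ i ∈ Finset.range n, d (n - i) = ∑ i ∈ Finset.range n, d (i + 1) := by
    rw [← Finset.sum_range_reflect]
    refine Finset.sum_congr rfl fun k hk => ?_
    have hk' := Finset.mem_range.1 hk
    rw [show n - (n - 1 - k) = k + 1 by omega]
  have hexp : ∑ i ∈ Finset.range n, (p + d (i + 1)) * ((p + d (n - i)) - (p + d (n + 1))) =
      p * ∑ i ∈ Finset.range n, d (i + 1) - p * (n * d (n + 1)) +
        ∑ i ∈ Finset.range n, d (i + 1) * d (n - i) -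
        d (n + 1) * ∑ i ∈ Finset.range n, d (i + 1) := by
    have hcard : ∑ i ∈ Finset.range n, d (n + 1) = n * d (n + 1) := by simp
    rw [← hcard]
    nth_rw 1 [← hrefl]
    simp only [Finset.mul_sum, ← Finset.sum_sub_distrib, ← Finset.sum_add_distrib]
    refine Finset.sum_congr rfl fun k _ => ?_
    ring
  rw [hexp, hpow, Function.comp_apply]
  field_simp

/-- The variance of the new indicator stays bounded, so the covariance sum governs the increment;
summing order n^(1-α) brings the factor 1/(2 - α). -/
theorem tendsto_variance_div_rpow {d V : ℕ → ℝ} {α D p : ℝ} (hα₀ : 0 < α) (hα : α < 1)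
    (hd : Tendsto (fun n : ℕ => d n / (n : ℝ) ^ (-α)) atTop (𝓝 D)) (hV0 : V 0 = 0)
    (hV : ∀ n, V (n + 1) = V n + ((p + d (n + 1)) - (p + d (n + 1)) ^ 2 +
      2 * ∑ i ∈ Finset.range n, (p + d (i + 1)) * ((p + d (n - i)) - (p + d (n + 1))))) :
    Tendsto (fun n : ℕ => V n / (n : ℝ) ^ (2 - α)) atTop
      (𝓝 (2 * p * D * α / ((1 - α) * (2 - α)))) := by
  have hd0 := (tendsto_zero_of_div_rpow_neg hα₀ hd).comp (tendsto_add_atTop_nat 1)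
  have hu := hd0.const_add p
  have hbdd := hu.sub (hu.pow 2)
  have hinf : Tendsto (fun n : ℕ => (n : ℝ) ^ (1 - α)) atTop atTop :=
    (tendsto_rpow_atTop (by linarith)).comp tendsto_natCast_atTop_atTop
  have hincr := (hbdd.div_atTop hinf).add
    ((tendsto_increment_div_rpow (p := p) hα₀ hα hd).const_mul 2)
  have hsum := tendsto_sum_div_rpow (a := fun n => V (n + 1) - V n) (β := 1 - α)
    (by linarith) (hincr.congr fun n => by
      rw [hV n, add_sub_cancel_left, add_div, mul_div_assoc]; rfl)
  simp_rw [Finset.sum_range_sub, hV0, sub_zero] at hsum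
  have h1 : 1 - α + 1 = 2 - α := by ring
  rw [h1] at hsum
  convert hsum using 2
  have h2 : 1 - α ≠ 0 := by linarith
  have h3 : 2 - α ≠ 0 := by linarith
  field_simp
  ring

end VarianceGrowth

/-! ### The law of the return time and the renewal sequence -/

section ReturnTimes

open Topology

/-- The sums `∑ k ≥ n, P(T > k)` of the tail probabilities of the return time `T` to `0`. -/
noncomputable def tailSum (π₀ α : ℝ) (n : ℕ) : ℝ :=
  if n = 0 then 1 / π₀ else (1 - π₀) / π₀ * (n : ℝ) ^ (-α)

/-- The tail probabilities `P(T > n)` of the return time `T` to `0`. -/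
noncomputable def survival (π₀ α : ℝ) (n : ℕ) : ℝ := tailSum π₀ α n - tailSum π₀ α (n + 1)

variable {π₀ α : ℝ}

theorem tailSum_succ (n : ℕ) :
    tailSum π₀ α (n + 1) = (1 - π₀) / π₀ * ((n + 1 : ℕ) : ℝ) ^ (-α) := by
  simp [tailSum]

theorem survival_succ (n : ℕ) : survival π₀ α (n + 1) =
    (1 - π₀) / π₀ * (((n : ℝ) + 1) ^ (-α) - ((n : ℝ) + 2) ^ (-α)) := by
  rw [survival, tailSum_succ, tailSum_succ]
  push_cast
  rw [show (n : ℝ) + 1 + 1 = n + 2 by ring]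
  ring

/-- This is what the separate value 1/π₀ of `tailSum` at 0 is for: a return takes at least one step.
-/
theorem survival_zero (hπ₀ : 0 < π₀) : survival π₀ α 0 = 1 := by
  rw [survival, tailSum_succ]
  simp only [tailSum, if_true, zero_add, Nat.cast_one, Real.one_rpow]
  field_simp
  ring

theorem jumpProb_eq_sub (hπ₀ : 0 < π₀) (k : ℕ) :
    jumpProb π₀ α k = survival π₀ α k - survival π₀ α (k + 1) := by
  rcases k with _ | k
  · rw [survival_zero hπ₀, survival_succ]
    simp [jumpProb]
  · rw [survival_succ, survival_succ, jumpProb, if_neg (Nat.succ_ne_zero k)]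
    push_cast
    rw [show (k : ℝ) + 1 + 1 = k + 2 by ring, show (k : ℝ) + 1 + 2 = k + 3 by ring]
    ring

theorem survival_nonneg (hπ₀ : 0 < π₀) (hπ₁ : π₀ < 1) (hα₀ : 0 < α) (n : ℕ) :
    0 ≤ survival π₀ α n := by
  rcases n with _ | n
  · rw [survival_zero hπ₀]; exact zero_le_one
  · rw [survival_succ]
    refine mul_nonneg (div_nonneg (by linarith) hπ₀.le) (sub_nonneg.2 ?_)
    exact Real.rpow_le_rpow_of_nonpos (by positivity) (by linarith) (by linarith)

/-- With x = 2^α, f 0 = (π₀(2x - 1) - (x - 1))/(π₀ x), so `hvalid` is exactly positivity. Strictness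
makes the return time aperiodic. -/
theorem jumpProb_zero_pos (hπ₀ : 0 < π₀) (hα₀ : 0 < α)
    (hvalid : ((2 : ℝ) ^ α - 1) / ((2 : ℝ) ^ (α + 1) - 1) < π₀) : 0 < jumpProb π₀ α 0 := by
  have h1 : 1 < (2 : ℝ) ^ α := Real.one_lt_rpow (by norm_num) hα₀
  rw [Real.rpow_add_one (by norm_num), div_lt_iff₀ (by linarith)] at hvalid
  rw [jumpProb, if_pos rfl, Real.rpow_neg (by norm_num)]
  set x := (2 : ℝ) ^ α
  have h2 : 1 - (1 - π₀) / π₀ * (1 - x⁻¹) = (π₀ * (x * 2 - 1) - (x - 1)) / (π₀ * x) := by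
    field_simp
    ring
  rw [h2]
  have : 0 < x := by linarith
  exact div_pos (by linarith) (by positivity)

/-- Convexity of x^(-α), from (n + 1)(n + 3) ≤ (n + 2)² and the AM–GM inequality. -/
theorem two_mul_rpow_neg_le (hα₀ : 0 < α) (n : ℕ) :
    2 * ((n : ℝ) + 2) ^ (-α) ≤ ((n : ℝ) + 1) ^ (-α) + ((n : ℝ) + 3) ^ (-α) := by
  have hx : (0 : ℝ) < (n : ℝ) + 1 := by positivity
  have hy : (0 : ℝ) < (n : ℝ) + 3 := by positivity
  have hm : (0 : ℝ) < (n : ℝ) + 2 := by positivity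
  have hsq : ∀ x : ℝ, 0 < x → x ^ (-α) = (x ^ (-α / 2)) ^ 2 := fun x hx => by
    rw [← Real.rpow_natCast, ← Real.rpow_mul hx.le]
    norm_num
  have h1 : ((n : ℝ) + 2) ^ (-α) ≤ ((n : ℝ) + 1) ^ (-α / 2) * ((n : ℝ) + 3) ^ (-α / 2) := by
    rw [hsq _ hm, ← Real.mul_rpow hx.le hy.le, sq, ← Real.mul_rpow hm.le hm.le]
    exact Real.rpow_le_rpow_of_nonpos (by positivity) (by nlinarith) (by linarith)
  rw [hsq _ hx, hsq _ hy]
  nlinarith [sq_nonneg (((n : ℝ) + 1) ^ (-α / 2) - ((n : ℝ) + 3) ^ (-α / 2))]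

theorem jumpProb_nonneg (hπ₀ : 0 < π₀) (hπ₁ : π₀ < 1) (hα₀ : 0 < α)
    (hvalid : ((2 : ℝ) ^ α - 1) / ((2 : ℝ) ^ (α + 1) - 1) < π₀) (k : ℕ) :
    0 ≤ jumpProb π₀ α k := by
  rcases k with _ | k
  · exact (jumpProb_zero_pos hπ₀ hα₀ hvalid).le
  · rw [jumpProb, if_neg (Nat.succ_ne_zero k)]
    refine mul_nonneg (div_nonneg (by linarith) hπ₀.le) ?_
    have := two_mul_rpow_neg_le hα₀ k
    push_cast
    rw [show (k : ℝ) + 1 + 1 = k + 2 by ring, show (k : ℝ) + 1 + 2 = k + 3 by ring]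
    linarith

theorem tendsto_tailSum (hα₀ : 0 < α) : Tendsto (tailSum π₀ α) atTop (𝓝 0) := by
  rw [← tendsto_add_atTop_iff_nat 1]
  simp_rw [tailSum_succ]
  have h := ((tendsto_rpow_neg_atTop hα₀).comp
    (tendsto_natCast_atTop_atTop.comp (tendsto_add_atTop_nat 1))).const_mul ((1 - π₀) / π₀)
  rw [mul_zero] at h
  exact h

theorem tendsto_survival (hα₀ : 0 < α) : Tendsto (survival π₀ α) atTop (𝓝 0) := by
  have h := (tendsto_tailSum (π₀ := π₀) hα₀).sub
    ((tendsto_tailSum (π₀ := π₀) hα₀).comp (tendsto_add_atTop_nat 1))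
  rw [sub_zero] at h
  exact h

theorem sum_range_survival (n : ℕ) :
    ∑ k ∈ Finset.range n, survival π₀ α k = 1 / π₀ - tailSum π₀ α n := by
  simp only [survival]
  rw [Finset.sum_range_sub']
  simp [tailSum]

theorem hasSum_survival (hπ₀ : 0 < π₀) (hπ₁ : π₀ < 1) (hα₀ : 0 < α) :
    HasSum (survival π₀ α) (1 / π₀) := by
  rw [hasSum_iff_tendsto_nat_of_nonneg (survival_nonneg hπ₀ hπ₁ hα₀)]
  simp_rw [sum_range_survival]
  simpa using (tendsto_tailSum (π₀ := π₀) hα₀).const_sub (1 / π₀)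

theorem sum_range_jumpProb (hπ₀ : 0 < π₀) (n : ℕ) :
    ∑ k ∈ Finset.range n, jumpProb π₀ α k = 1 - survival π₀ α n := by
  simp_rw [jumpProb_eq_sub hπ₀]
  rw [Finset.sum_range_sub', survival_zero hπ₀]

theorem hasSum_jumpProb (hπ₀ : 0 < π₀) (hπ₁ : π₀ < 1) (hα₀ : 0 < α)
    (hvalid : ((2 : ℝ) ^ α - 1) / ((2 : ℝ) ^ (α + 1) - 1) < π₀) :
    HasSum (jumpProb π₀ α) 1 := by
  rw [hasSum_iff_tendsto_nat_of_nonneg (jumpProb_nonneg hπ₀ hπ₁ hα₀ hvalid)]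
  simp_rw [sum_range_jumpProb hπ₀]
  simpa using (tendsto_survival (π₀ := π₀) hα₀).const_sub 1

theorem tendsto_survival_div_rpow :
    Tendsto (fun n : ℕ => survival π₀ α n / (n : ℝ) ^ (-(1 + α))) atTop
      (𝓝 (α * (1 - π₀) / π₀)) := by
  have h := (tendsto_rpow_succ_sub_div (-α)).const_mul (-((1 - π₀) / π₀))
  rw [show -((1 - π₀) / π₀) * -α = α * (1 - π₀) / π₀ by ring] at h
  refine h.congr' ?_
  filter_upwards [eventually_gt_atTop 0] with n hn
  obtain ⟨n, rfl⟩ := Nat.exists_eq_succ_of_ne_zero hn.ne'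
  rw [Nat.succ_eq_add_one, survival_succ, show -(1 + α) = -α - 1 by ring]
  push_cast
  rw [show (n : ℝ) + 1 + 1 = n + 2 by ring]
  ring

theorem tendsto_mul_survival_zero (hα₀ : 0 < α) :
    Tendsto (fun n : ℕ => n * survival π₀ α n) atTop (𝓝 0) := by
  refine tendsto_zero_of_div_rpow_neg hα₀
    ((tendsto_survival_div_rpow (π₀ := π₀) (α := α)).congr' ?_)
  filter_upwards [eventually_gt_atTop 0] with n hn
  have hn' : (0 : ℝ) < n := by exact_mod_cast hn
  rw [show -(1 + α) = -α - 1 by ring, Real.rpow_sub_one hn'.ne']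
  field_simp

/-- By (1 - z) R(z) = 1 - ∑ f k z^(k+1), a zero z makes the average of the z^(k+1) with weights f k
equal to 1. As |z| ≤ 1 and f 0 > 0, this forces z = 1; but R(1) = 1/π₀. -/
theorem tsum_survival_mul_pow_ne_zero (hπ₀ : 0 < π₀) (hπ₁ : π₀ < 1) (hα₀ : 0 < α)
    (hvalid : ((2 : ℝ) ^ α - 1) / ((2 : ℝ) ^ (α + 1) - 1) < π₀) {z : ℂ} (hz : ‖z‖ ≤ 1) :
    ∑' k, (survival π₀ α k : ℂ) * z ^ k ≠ 0 := by
  intro h0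
  have hr := hasSum_survival hπ₀ hπ₁ hα₀
  have hsum : Summable fun k => (survival π₀ α k : ℂ) * z ^ k := by
    refine Summable.of_norm_bounded hr.summable fun k => ?_
    rw [norm_mul, norm_pow, Complex.norm_real,
      Real.norm_of_nonneg (survival_nonneg hπ₀ hπ₁ hα₀ k)]
    exact mul_le_of_le_one_right (survival_nonneg hπ₀ hπ₁ hα₀ k)
      (pow_le_one₀ (norm_nonneg _) hz)
  have h1 := hsum.hasSum
  rw [h0] at h1
  have h2 : HasSum (fun k => (survival π₀ α k : ℂ) * z ^ (k + 1)) 0 := by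
    simpa [pow_succ, mul_assoc] using h1.mul_right z
  have h3 := (hasSum_nat_add_iff' 1).2 h1
  have h4 : HasSum (fun k => (jumpProb π₀ α k : ℂ) * z ^ (k + 1)) 1 := by
    have h := h2.sub h3
    simp only [Finset.sum_range_one, survival_zero hπ₀] at h
    have e1 : ∀ k, (jumpProb π₀ α k : ℂ) * z ^ (k + 1) = (survival π₀ α k : ℂ) * z ^ (k + 1) -
        (survival π₀ α (k + 1) : ℂ) * z ^ (k + 1) := fun k => by
      rw [jumpProb_eq_sub hπ₀, Complex.ofReal_sub, sub_mul]
    have e2 : (0 : ℂ) - (0 - ((1 : ℝ) : ℂ) * z ^ 0) = 1 := by simp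
    rw [e2] at h
    simp_rw [e1]
    exact h
  have h5 : HasSum (fun k => jumpProb π₀ α k * (1 - (z ^ (k + 1)).re)) 0 := by
    have h := (hasSum_jumpProb hπ₀ hπ₁ hα₀ hvalid).sub (Complex.hasSum_re h4)
    simpa [mul_sub] using h
  have hre : ∀ k, (z ^ (k + 1)).re ≤ 1 := fun k =>
    (Complex.re_le_norm _).trans (by rw [norm_pow]; exact pow_le_one₀ (norm_nonneg _) hz)
  have h6 := (hasSum_zero_iff_of_nonneg fun k =>
    mul_nonneg (jumpProb_nonneg hπ₀ hπ₁ hα₀ hvalid k) (sub_nonneg.2 (hre k))).1 h5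
  have h7 := congrFun h6 0
  simp only [Pi.zero_apply, zero_add, pow_one, mul_eq_zero,
    (jumpProb_zero_pos hπ₀ hα₀ hvalid).ne', false_or] at h7
  have hz1 : z = 1 := by
    have h8 : z.re = 1 := by linarith
    have h9 : z.im = 0 := by
      have h10 : ‖z‖ ^ 2 ≤ 1 := pow_le_one₀ (norm_nonneg _) hz
      rw [← Complex.normSq_eq_norm_sq, Complex.normSq_apply, h8] at h10
      nlinarith
    exact Complex.ext (by simpa using h8) (by simpa using h9)
  subst hz1
  simp only [one_pow, mul_one] at h1
  have h11 := h1.unique (Complex.hasSum_ofReal.2 hr)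
  have h12 : (1 / π₀ : ℝ) = 0 := by exact_mod_cast h11.symm
  exact (one_div_pos.2 hπ₀).ne' h12

theorem tsum_inverse {r s : ℕ → ℝ} {a : ℝ} (hr : HasSum r a) (hr' : Summable fun k => |r k|)
    (hs : Summable fun k => |s k|) (hrs : PowerSeries.mk r * PowerSeries.mk s = 1) :
    a * ∑' k, s k = 1 := by
  rw [← hr.tsum_eq, tsum_mul_tsum_eq_tsum_sum_range_of_summable_norm (f := r) (g := s)
    (by simpa only [Real.norm_eq_abs] using hr') (by simpa only [Real.norm_eq_abs] using hs)]
  have h : ∀ n, ∑ k ∈ Finset.range (n + 1), r k * s (n - k) = if n = 0 then 1 else 0 := fun n => by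
    have := coeff_mk_mul r (PowerSeries.mk s) n
    rw [hrs, PowerSeries.coeff_one] at this
    simpa using this.symm
  simp_rw [h]
  simp

/-- The renewal sequence of the return times to `0`, with its rate of convergence. -/
theorem exists_renewal (hπ₀ : 0 < π₀) (hπ₁ : π₀ < 1) (hα₀ : 0 < α) (hα₁ : α < 1)
    (hvalid : ((2 : ℝ) ^ α - 1) / ((2 : ℝ) ^ (α + 1) - 1) < π₀) :
    ∃ u : ℕ → ℝ, u 0 = 1 ∧
      (∀ n, u (n + 1) = ∑ k ∈ Finset.range (n + 1), jumpProb π₀ α k * u (n - k)) ∧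
      Tendsto (fun n : ℕ => (u n - π₀) / (n : ℝ) ^ (-α)) atTop (𝓝 (π₀ * (1 - π₀))) := by
  have hr := hasSum_survival hπ₀ hπ₁ hα₀
  have hr' : Summable fun k => |survival π₀ α k| := hr.summable.abs
  obtain ⟨s, hs, hrs⟩ := exists_summable_inverse hr'
    fun z => tsum_survival_mul_pow_ne_zero hπ₀ hπ₁ hα₀ hvalid
  have hsum : ∑' k, s k = π₀ := by
    have := tsum_inverse hr hr' hs hrs
    field_simp at this
    exact this
  set R := PowerSeries.mk (survival π₀ α) with hR
  set S := PowerSeries.mk s with hS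
  set G : PowerSeries ℝ := PowerSeries.mk 1 with hG
  have hG1 : G * (1 - PowerSeries.X) = 1 := PowerSeries.mk_one_mul_one_sub_eq_one ℝ
  set U := S * G with hU
  have hF : PowerSeries.X * PowerSeries.mk (jumpProb π₀ α) = 1 - (1 - PowerSeries.X) * R := by
    ext n
    rw [sub_mul, one_mul, map_sub, map_sub]
    rcases n with _ | n
    · simp [hR, survival_zero hπ₀]
    · simp [hR, PowerSeries.coeff_succ_X_mul, PowerSeries.coeff_one, jumpProb_eq_sub hπ₀]
  have hUeq : U = 1 + PowerSeries.X * (PowerSeries.mk (jumpProb π₀ α) * U) := by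
    linear_combination (-U) * hF + R * S * hG1 + hrs
  -- The coefficient of z^n in the bracket is π₀ times `tailSum` at n + 1, that is, exactly (1 -
  -- π₀)(n + 1)^(-α).
  have hDeq : U - PowerSeries.C π₀ * G = S * (G - PowerSeries.C π₀ * (R * G)) := by
    linear_combination PowerSeries.C π₀ * G * hrs
  clear_value U
  refine ⟨fun n => PowerSeries.coeff n U, ?_, fun n => ?_, ?_⟩
  · rw [hUeq]; simp
  · change PowerSeries.coeff (n + 1) U = _
    conv_lhs => rw [hUeq]
    rw [map_add, PowerSeries.coeff_succ_X_mul, coeff_mk_mul]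
    simp [PowerSeries.coeff_one]
  · have h1 := (tendsto_div_rpow_succ (tendsto_sum_mul_rpow_div hα₀ hα₁ hs
      (tendsto_mul_inverse_zero hs hrs (tendsto_mul_survival_zero hα₀)))).const_mul (1 - π₀)
    rw [hsum, mul_comm (1 - π₀)] at h1
    refine h1.congr fun n => ?_
    have h2 := congrArg (PowerSeries.coeff n) hDeq
    rw [map_sub, PowerSeries.coeff_C_mul, coeff_mk_mul] at h2
    have hG' : ∀ k, PowerSeries.coeff k G = 1 := fun k => by simp [hG]
    have h3 : ∀ k, PowerSeries.coeff k (R * G) = 1 / π₀ - tailSum π₀ α (k + 1) := fun k => by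
      rw [hR, coeff_mk_mul]
      simp [hG', sum_range_survival]
    rw [hG', mul_one] at h2
    simp only [h2]
    rw [← mul_div_assoc, Finset.mul_sum]
    congr 1
    refine Finset.sum_congr rfl fun k hk => ?_
    rw [map_sub, PowerSeries.coeff_C_mul, hG', h3, tailSum_succ,
      Nat.sub_add_comm (Nat.lt_succ_iff.1 (Finset.mem_range.1 hk))]
    field_simp
    ring

end ReturnTimes

theorem hasSum_of_eq {ι : Type*} {f g : ι → ℝ} {x : ℝ} (hg : HasSum g x)
    (h : ∀ i, f i = g i) : HasSum f x := by
  rwa [funext h]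

/-! ### The Markov property for past events, and first step analysis -/

section MarkovProperty

variable {Ω : Type*} [MeasurableSpace Ω] {μ : Measure Ω} {X : ℕ → Ω → ℕ} {p : ℕ → ℕ → ℝ}

theorem hasSum_measureReal_fiber [IsFiniteMeasure μ] {γ : Type*} [Countable γ]
    [MeasurableSpace γ] [MeasurableSingletonClass γ] {Z : Ω → γ} (hZ : Measurable Z) {S : Set Ω}
    (hS : MeasurableSet S) : HasSum (fun z => μ.real (S ∩ {ω | Z ω = z})) (μ.real S) := by
  have hm : ∀ z, MeasurableSet (S ∩ {ω | Z ω = z}) := fun z =>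
    hS.inter (hZ (measurableSet_singleton z))
  have hu : ⋃ z, S ∩ {ω | Z ω = z} = S := by
    ext ω; simp
  have h1 : μ S = ∑' z, μ (S ∩ {ω | Z ω = z}) := by
    rw [← measure_iUnion _ hm, hu]
    intro z w hzw
    refine Set.disjoint_left.2 fun ω h2 h3 => hzw ?_
    exact h2.2.symm.trans h3.2
  have h2 := ENNReal.hasSum_toReal (f := fun z => μ (S ∩ {ω | Z ω = z}))
    (by rw [← h1]; exact measure_ne_top _ _)
  rw [← ENNReal.tsum_toReal_eq fun z => measure_ne_top _ _, ← h1] at h2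
  exact h2

/-- `E` is determined by the values of `X` at the times `0, …, n`. -/
def PastEvent (X : ℕ → Ω → ℕ) (n : ℕ) (E : Set Ω) : Prop :=
  ∀ ω ω', (∀ i ≤ n, X i ω = X i ω') → ω ∈ E → ω' ∈ E

theorem pastEvent_univ {Ω : Type*} {X : ℕ → Ω → ℕ} (n : ℕ) : PastEvent X n Set.univ := fun _ _ _ _ => Set.mem_univ _

theorem PastEvent.inter_succ {Ω : Type*} {X : ℕ → Ω → ℕ} {n : ℕ} {E : Set Ω} (hE : PastEvent X n E) (a : ℕ) :
    PastEvent X (n + 1) (E ∩ {ω | X n ω = a}) := fun ω ω' h hω =>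
  ⟨hE ω ω' (fun i hi => h i (hi.trans (Nat.le_succ n))) hω.1,
    (h n (Nat.le_succ n)).symm.trans hω.2⟩

theorem measurable_history (hX : ∀ n, Measurable (X n)) (n : ℕ) :
    Measurable fun ω => fun i : Fin (n + 1) => X i ω :=
  measurable_pi_lambda _ fun i => hX i

/-- Histories up to time n form a countable space, all of whose subsets are measurable. -/
theorem PastEvent.measurableSet (hX : ∀ n, Measurable (X n)) {n : ℕ} {E : Set Ω}
    (hE : PastEvent X n E) : MeasurableSet E := by
  have h : E = (fun ω => fun i : Fin (n + 1) => X i ω) ⁻¹'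
      ((fun ω => fun i : Fin (n + 1) => X i ω) '' E) := by
    refine Set.Subset.antisymm (Set.subset_preimage_image _ _) ?_
    rintro ω ⟨ω', hω', he⟩
    exact hE ω' ω (fun i hi => congrFun he ⟨i, Nat.lt_succ_iff.2 hi⟩) hω'
  rw [h]
  exact measurable_history hX n (Set.to_countable _).measurableSet

theorem measurableSet_eq_nat (hX : ∀ n, Measurable (X n)) (n a : ℕ) :
    MeasurableSet {ω | X n ω = a} := hX n (measurableSet_singleton a)

/-- The one-step Markov property, given an arbitrary event of the past. -/
theorem IsMarkovChain.measureReal_step [IsFiniteMeasure μ] (hX : IsMarkovChain p μ X) {n : ℕ}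
    {E : Set Ω} (hE : PastEvent X n E) (a b : ℕ) :
    μ.real (E ∩ {ω | X n ω = a} ∩ {ω | X (n + 1) ω = b}) =
      μ.real (E ∩ {ω | X n ω = a}) * p a b := by
  have hm := hX.measurable
  have hmE := (hE.measurableSet hm).inter (measurableSet_eq_nat hm n a)
  have h1 := hasSum_measureReal_fiber (μ := μ) (measurable_history hm n)
    (hmE.inter (measurableSet_eq_nat hm (n + 1) b))
  have h2 := (hasSum_measureReal_fiber (μ := μ) (measurable_history hm n) hmE).mul_right (p a b)
  refine h1.unique (hasSum_of_eq h2 fun z => ?_)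
  -- For each history z, the event either contains the whole cylinder of z, where `markov` applies,
  -- or misses it.
  by_cases hz : ∃ ω₀, (ω₀ ∈ E ∧ X n ω₀ = a) ∧ (fun i : Fin (n + 1) => X i ω₀) = z
  · obtain ⟨ω₀, ⟨hω₀, ha⟩, rfl⟩ := hz
    have hset : E ∩ {ω | X n ω = a} ∩ {ω | (fun i : Fin (n + 1) => X i ω) =
        fun i : Fin (n + 1) => X i ω₀} = {ω | ∀ i ≤ n, X i ω = X i ω₀} := by
      ext ω
      constructor
      · rintro ⟨-, h⟩ i hi
        exact congrFun h ⟨i, Nat.lt_succ_iff.2 hi⟩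
      · intro h
        exact ⟨⟨hE ω₀ ω (fun i hi => (h i hi).symm) hω₀, (h n le_rfl).trans ha⟩,
          funext fun i => h i (Nat.lt_succ_iff.1 i.2)⟩
    have hmk := hX.markov n (fun i => if i ≤ n then X i ω₀ else b)
    have hset1 : {ω | ∀ i ≤ n, X i ω = if i ≤ n then X i ω₀ else b} =
        {ω | ∀ i ≤ n, X i ω = X i ω₀} := by
      ext ω
      exact forall₂_congr fun i hi => by rw [if_pos hi]
    have hset2 : {ω | ∀ i ≤ n + 1, X i ω = if i ≤ n then X i ω₀ else b} =
        {ω | ∀ i ≤ n, X i ω = X i ω₀} ∩ {ω | X (n + 1) ω = b} := by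
      ext ω
      constructor
      · intro h
        refine ⟨fun i hi => ?_, ?_⟩
        · simpa [hi] using h i (hi.trans (Nat.le_succ n))
        · simpa using h (n + 1) le_rfl
      · rintro ⟨h, h'⟩ i hi
        rcases Nat.le_succ_iff.1 hi with h3 | h3
        · rw [if_pos h3]; exact h i h3
        · subst h3; simpa using h'
    rw [hset1, hset2, if_pos le_rfl, if_neg (Nat.not_succ_le_self n), ha] at hmk
    rw [Set.inter_right_comm, hset, hmk]
  · have hset : E ∩ {ω | X n ω = a} ∩ {ω | (fun i : Fin (n + 1) => X i ω) = z} = ∅ := by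
      rw [Set.eq_empty_iff_forall_notMem]
      rintro ω ⟨h, h'⟩
      exact hz ⟨ω, h, h'⟩
    rw [Set.inter_right_comm, hset]
    simp

/-- First step analysis: if the event `G (m + 1) n` means that the state at time `n + 1` lies in
`K` and `G m (n + 1)` occurs, then its probability given the past up to time `n` is computed
recursively. -/
theorem IsMarkovChain.measureReal_future [IsFiniteMeasure μ] (hX : IsMarkovChain p μ X)
    {G : ℕ → ℕ → Set Ω} {w : ℕ → ℕ → ℝ} {K : Set ℕ} (hG : ∀ m n, MeasurableSet (G m n))
    (h0 : ∀ n a E, PastEvent X n E →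
      μ.real (E ∩ {ω | X n ω = a} ∩ G 0 n) = μ.real (E ∩ {ω | X n ω = a}) * w 0 a)
    (hstep : ∀ m n ω, ω ∈ G (m + 1) n ↔ X (n + 1) ω ∈ K ∧ ω ∈ G m (n + 1))
    (hw : ∀ m a, HasSum (fun b => p a b * K.indicator (w m) b) (w (m + 1) a))
    (m n a : ℕ) (E : Set Ω) (hE : PastEvent X n E) :
    μ.real (E ∩ {ω | X n ω = a} ∩ G m n) = μ.real (E ∩ {ω | X n ω = a}) * w m a := by
  -- E must vary: the induction hypothesis is applied at time n + 1 with the larger past E ∩ {X n =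
  -- a}.
  induction m generalizing n a E with
  | zero => exact h0 n a E hE
  | succ m ih =>
    have hm := hX.measurable
    have h1 := hasSum_measureReal_fiber (μ := μ) (hm (n + 1))
      (((hE.inter_succ a).measurableSet hm).inter (hG (m + 1) n))
    have h2 := (hw m a).mul_left (μ.real (E ∩ {ω | X n ω = a}))
    refine h1.unique (hasSum_of_eq h2 fun b => ?_)
    by_cases hb : b ∈ K
    · have hset : E ∩ {ω | X n ω = a} ∩ G (m + 1) n ∩ {ω | X (n + 1) ω = b} =
          E ∩ {ω | X n ω = a} ∩ {ω | X (n + 1) ω = b} ∩ G m (n + 1) := by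
        ext ω
        constructor
        · rintro ⟨⟨h, h'⟩, h''⟩
          exact ⟨⟨h, h''⟩, ((hstep m n ω).1 h').2⟩
        · rintro ⟨⟨h, h''⟩, h'⟩
          have hX1 : X (n + 1) ω = b := h''
          exact ⟨⟨h, (hstep m n ω).2 ⟨by rwa [hX1], h'⟩⟩, h''⟩
      rw [hset, ih (n + 1) b _ (hE.inter_succ a), hX.measureReal_step hE,
        Set.indicator_of_mem hb, mul_assoc]
    · have hset : E ∩ {ω | X n ω = a} ∩ G (m + 1) n ∩ {ω | X (n + 1) ω = b} = ∅ := by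
        rw [Set.eq_empty_iff_forall_notMem]
        rintro ω ⟨⟨-, h'⟩, h''⟩
        have hX1 : X (n + 1) ω = b := h''
        exact hb (hX1 ▸ ((hstep m n ω).1 h').1)
      rw [hset, Set.indicator_of_notMem hb]
      simp

theorem measureReal_cond {s : Set Ω} (hs : MeasurableSet s) (t : Set Ω) :
    (cond μ s).real t = (μ.real s)⁻¹ * μ.real (s ∩ t) := by
  rw [measureReal_def, cond_apply hs, ENNReal.toReal_mul, ENNReal.toReal_inv]
  rfl

/-- Conditioning on the initial state only rescales the paths from 0 by a common factor and kills
the others. -/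
theorem IsMarkovChain.cond_eq_zero (hX : IsMarkovChain p μ X) :
    IsMarkovChain p (cond μ {ω | X 0 ω = 0}) X := by
  refine ⟨hX.measurable, fun n x => ?_⟩
  have hm := measurableSet_eq_nat hX.measurable 0 0
  rw [measureReal_cond hm, measureReal_cond hm]
  have hset : ∀ n, {ω | X 0 ω = 0} ∩ {ω | ∀ i ≤ n, X i ω = x i} =
      if x 0 = 0 then {ω | ∀ i ≤ n, X i ω = x i} else ∅ := fun n => by
    split_ifs with h
    · refine Set.inter_eq_right.2 fun ω hω => ?_
      exact (hω 0 (Nat.zero_le n)).trans h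
    · rw [Set.eq_empty_iff_forall_notMem]
      rintro ω ⟨h1, h2⟩
      exact h ((h2 0 (Nat.zero_le n)).symm.trans h1)
  rw [hset, hset]
  split_ifs
  · rw [hX.markov n x, mul_assoc]
  · simp

end MarkovProperty

/-! ### Visiting and avoiding 0 -/

section Transition

theorem hasSum_transition_succ (f : ℕ → ℝ) (i : ℕ) (g : ℕ → ℝ) :
    HasSum (fun b => transition f (i + 1) b * g b) (g i) := by
  have h := hasSum_single (f := fun b => transition f (i + 1) b * g b) i
    (fun b hb => by simp [transition, hb])
  simpa [transition] using h

/-- The probability of being in `0` after `m` steps, starting from `a`. -/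
def visitProb (u : ℕ → ℝ) (m a : ℕ) : ℝ := if m < a then 0 else u (m - a)

/-- From a > 0 the descent is deterministic. From 0, only jumps to b ≤ m allow a return in time,
which leaves the renewal recursion. -/
theorem hasSum_visitProb {f u : ℕ → ℝ}
    (hu : ∀ n, u (n + 1) = ∑ k ∈ Finset.range (n + 1), f k * u (n - k)) (m a : ℕ) :
    HasSum (fun b => transition f a b * Set.univ.indicator (visitProb u m) b)
      (visitProb u (m + 1) a) := by
  simp only [Set.indicator_univ]
  rcases a with _ | i
  · have h : visitProb u (m + 1) 0 =
        ∑ b ∈ Finset.range (m + 1), transition f 0 b * visitProb u m b := by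
      simp only [visitProb, Nat.not_lt_zero, if_false, Nat.sub_zero, hu]
      refine Finset.sum_congr rfl fun k hk => ?_
      rw [if_neg (not_lt.2 (Nat.lt_succ_iff.1 (Finset.mem_range.1 hk)))]
      rfl
    rw [h]
    refine hasSum_sum_of_ne_finset_zero fun b hb => ?_
    rw [Finset.mem_range, not_lt] at hb
    rw [visitProb, if_pos (Nat.lt_of_succ_le hb), mul_zero]
  · have h := hasSum_transition_succ f i (visitProb u m)
    simpa [visitProb] using h

/-- The probability of not visiting `0` in the next `m` steps, starting from `a`. -/
def avoidProb (r : ℕ → ℝ) (m a : ℕ) : ℝ := if a = 0 then r m else if m < a then 1 else 0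

/-- Away from 0, avoiding it for m steps means starting above m; from 0 one gets the tail ∑ f b over
b > m. -/
theorem hasSum_avoidProb {f r : ℕ → ℝ} (hf : HasSum f 1)
    (hr : ∀ n, ∑ k ∈ Finset.range n, f k = 1 - r n) (m a : ℕ) :
    HasSum (fun b => transition f a b * ({0}ᶜ : Set ℕ).indicator (avoidProb r m) b)
      (avoidProb r (m + 1) a) := by
  have hind : ∀ b, ({0}ᶜ : Set ℕ).indicator (avoidProb r m) b = if m < b then 1 else 0 := fun b => by
    rcases b with _ | b
    · simp
    · rw [Set.indicator_of_mem (by simp), avoidProb, if_neg (Nat.succ_ne_zero b)]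
  simp_rw [hind]
  rcases a with _ | i
  · have h1 : HasSum (fun b => if b < m + 1 then f b else 0) (1 - r (m + 1)) := by
      rw [← hr (m + 1)]
      have h2 := hasSum_sum_of_ne_finset_zero (s := Finset.range (m + 1))
        (f := fun b => if b < m + 1 then f b else 0) (L := .unconditional ℕ)
        (fun b hb => if_neg (fun h => hb (Finset.mem_range.2 h)))
      rwa [Finset.sum_congr rfl fun b hb => if_pos (Finset.mem_range.1 hb)] at h2
    have h3 := hf.sub h1
    rw [sub_sub_cancel] at h3
    rw [avoidProb, if_pos rfl]
    refine hasSum_of_eq h3 fun b => ?_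
    rcases lt_or_ge m b with hb | hb
    · rw [if_pos hb, if_neg (by omega), mul_one, sub_zero]
      rfl
    · simp [not_lt.2 hb, Nat.lt_succ_iff.2 hb]
  · have h := hasSum_transition_succ f i fun b => if m < b then 1 else 0
    simpa [avoidProb] using h

variable {Ω : Type*} [MeasurableSpace Ω] {μ : Measure Ω} {X : ℕ → Ω → ℕ} {f u r : ℕ → ℝ}

theorem measureReal_visit [IsFiniteMeasure μ] (hX : IsMarkovChain (transition f) μ X)
    (hu0 : u 0 = 1) (hu : ∀ n, u (n + 1) = ∑ k ∈ Finset.range (n + 1), f k * u (n - k))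
    (i k : ℕ) : μ.real ({ω | X i ω = 0} ∩ {ω | X (i + k) ω = 0}) =
      μ.real {ω | X i ω = 0} * u k := by
  have h := hX.measureReal_future (G := fun m n => {ω | X (n + m) ω = 0}) (w := visitProb u)
    (K := Set.univ) (fun m n => measurableSet_eq_nat hX.measurable _ _) ?_ ?_
    (hasSum_visitProb hu) k i 0 Set.univ (pastEvent_univ i)
  · simpa [visitProb] using h
  · intro n a E _
    rcases Nat.eq_zero_or_pos a with rfl | ha
    · simp [visitProb, hu0, Set.inter_assoc]
    · have hset : E ∩ {ω | X n ω = a} ∩ {ω | X (n + 0) ω = 0} = ∅ := by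
        rw [Set.eq_empty_iff_forall_notMem]
        rintro ω ⟨⟨-, h1⟩, h2⟩
        exact ha.ne (h2.symm.trans h1)
      rw [hset]
      simp [visitProb, ha]
  · intro m n ω
    simp only [Set.mem_univ, true_and, Set.mem_ofPred_eq]
    rw [show n + (m + 1) = n + 1 + m by ring]

theorem measureReal_avoid [IsFiniteMeasure μ] (hX : IsMarkovChain (transition f) μ X)
    (hf : HasSum f 1) (hr : ∀ n, ∑ k ∈ Finset.range n, f k = 1 - r n) (m : ℕ) :
    μ.real ({ω | X 0 ω = 0} ∩ {ω | ∀ k, 1 ≤ k → k ≤ m → X k ω ≠ 0}) =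
      μ.real {ω | X 0 ω = 0} * r m := by
  have hr0 : r 0 = 1 := by
    have := hr 0
    simp only [Finset.range_zero, Finset.sum_empty] at this
    linarith
  have h := hX.measureReal_future (G := fun m n => {ω | ∀ k, 1 ≤ k → k ≤ m → X (n + k) ω ≠ 0})
    (w := avoidProb r) (K := {0}ᶜ) (fun m n => ?_) ?_ ?_
    (hasSum_avoidProb hf hr) m 0 0 Set.univ (pastEvent_univ 0)
  · simpa [avoidProb] using h
  · have hset : {ω | ∀ k, 1 ≤ k → k ≤ m → X (n + k) ω ≠ 0} =
        ⋂ k, ⋂ _ : 1 ≤ k, ⋂ _ : k ≤ m, {ω | X (n + k) ω = 0}ᶜ := by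
      ext ω
      simp
    rw [hset]
    exact MeasurableSet.iInter fun k => MeasurableSet.iInter fun _ => MeasurableSet.iInter fun _ =>
      (measurableSet_eq_nat hX.measurable _ _).compl
  · intro n a E _
    have hset : {ω | ∀ k, 1 ≤ k → k ≤ 0 → X (n + k) ω ≠ 0} = Set.univ :=
      Set.eq_univ_of_forall fun ω k h1 h2 => absurd (h1.trans h2) (by norm_num)
    rw [hset, Set.inter_univ]
    rcases Nat.eq_zero_or_pos a with rfl | ha
    · simp [avoidProb, hr0]
    · simp [avoidProb, ha, ha.ne']
  · intro m n ω
    simp only [Set.mem_compl_iff, Set.mem_singleton_iff, Set.mem_ofPred_eq]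
    constructor
    · intro h
      refine ⟨h 1 le_rfl (by omega), fun k h1 h2 => ?_⟩
      rw [add_assoc, add_comm 1 k]
      exact h (k + 1) (by omega) (by omega)
    · rintro ⟨h1, h2⟩ k hk hk'
      rcases Nat.lt_or_ge k 2 with h3 | h3
      · rwa [show k = 1 by omega]
      · have := h2 (k - 1) (by omega) (by omega)
        rwa [show n + 1 + (k - 1) = n + k by omega] at this

end Transition

/-! ### Visits and the binary series as indicators -/

section Indicators

variable {Ω : Type*} [MeasurableSpace Ω] {μ : Measure Ω} {X : ℕ → Ω → ℕ}

theorem binary_eq_sub {Ω : Type*} {X : ℕ → Ω → ℕ} (i : ℕ) :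
    binary X i = fun ω => 1 - {ω | X i ω = 0}.indicator (1 : Ω → ℝ) ω := by
  funext ω
  by_cases h : X i ω = 0 <;> simp [binary, h]

theorem visits_succ {Ω : Type*} {X : ℕ → Ω → ℕ} (n : ℕ) : (fun ω => (visits X (n + 1) ω : ℝ)) =
    (fun ω => (visits X n ω : ℝ)) + {ω | X (n + 1) ω = 0}.indicator (1 : Ω → ℝ) := by
  funext ω
  rw [Pi.add_apply, visits, ← Finset.insert_Icc_right_eq_Icc_add_one (by omega),
    Finset.filter_insert]
  by_cases h : X (n + 1) ω = 0
  · rw [if_pos h, Finset.card_insert_of_notMem (by simp), Set.indicator_of_mem (by exact h)]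
    simp [visits]
  · rw [if_neg h, Set.indicator_of_notMem (by exact h)]
    simp [visits]

theorem visits_eq_sum {Ω : Type*} {X : ℕ → Ω → ℕ} (n : ℕ) : (fun ω => (visits X n ω : ℝ)) =
    fun ω => ∑ i ∈ Finset.range n, {ω | X (i + 1) ω = 0}.indicator (1 : Ω → ℝ) ω := by
  induction n with
  | zero => funext ω; simp [visits]
  | succ n ih =>
    rw [visits_succ, ih]
    funext ω
    rw [Finset.sum_range_succ]
    rfl

theorem memLp_indicator_one [IsFiniteMeasure μ] {A : Set Ω} (hA : MeasurableSet A) :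
    MemLp (A.indicator (1 : Ω → ℝ)) 2 μ :=
  memLp_indicator_const 2 hA (1 : ℝ) (Or.inr (measure_ne_top _ _))

theorem covariance_indicator_one [IsProbabilityMeasure μ] {A B : Set Ω} (hA : MeasurableSet A)
    (hB : MeasurableSet B) :
    covariance (A.indicator (1 : Ω → ℝ)) (B.indicator (1 : Ω → ℝ)) μ =
      μ.real (A ∩ B) - μ.real A * μ.real B := by
  rw [covariance_eq_sub (memLp_indicator_one hA) (memLp_indicator_one hB), integral_indicator_one hA,
    integral_indicator_one hB, ← Set.inter_indicator_one, integral_indicator_one (hA.inter hB)]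

end Indicators

/-! ### Construction of the chain from independent innovations -/

section Existence

theorem exists_probabilityMeasure {f : ℕ → ℝ} (hf : ∀ k, 0 ≤ f k) (hf1 : HasSum f 1) :
    ∃ P : Measure ℕ, IsProbabilityMeasure P ∧ ∀ k, P.real {k} = f k := by
  have h : HasSum (fun k => ENNReal.ofReal (f k)) 1 := by
    have h1 := ENNReal.ofReal_tsum_of_nonneg hf hf1.summable
    rw [hf1.tsum_eq, ENNReal.ofReal_one] at h1
    rw [h1]
    exact ENNReal.summable.hasSum
  let q : PMF ℕ := ⟨_, h⟩
  refine ⟨q.toMeasure, inferInstance, fun k => ?_⟩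
  rw [measureReal_def, PMF.toMeasure_apply_singleton _ _ (measurableSet_singleton k)]
  exact ENNReal.toReal_ofReal (hf k)

/-- The chain driven by innovations `ξ`: it starts at `ξ 0`, moves down by one at each step, and
jumps from `0` at time `n` to `ξ (n + 1)`. -/
def drivenChain : ℕ → (ℕ → ℕ) → ℕ
  | 0, ξ => ξ 0
  | n + 1, ξ => if drivenChain n ξ = 0 then ξ (n + 1) else drivenChain n ξ - 1

theorem measurable_drivenChain (n : ℕ) : Measurable (drivenChain n) := by
  induction n with
  | zero => exact measurable_pi_apply 0
  | succ n ih =>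
    refine Measurable.ite (ih (measurableSet_singleton 0)) (measurable_pi_apply _) ?_
    exact (measurable_from_top (f := fun k : ℕ => k - 1)).comp ih

/-- The innovations at time `n` that are compatible with the path `x`. -/
def drivenBox (x : ℕ → ℕ) : ℕ → Set ℕ
  | 0 => {x 0}
  | n + 1 => if x n = 0 then {x (n + 1)} else if x (n + 1) = x n - 1 then Set.univ else ∅

/-- Given the path so far, the next step constrains only the next innovation: a jump fixes it, a
descent leaves it free. So path events are boxes, and their product measure factorizes. -/
theorem drivenChain_path_eq (x : ℕ → ℕ) (n : ℕ) :
    {ξ | ∀ i ≤ n, drivenChain i ξ = x i} =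
      Set.pi (Finset.range (n + 1) : Set ℕ) (drivenBox x) := by
  induction n with
  | zero =>
    ext ξ
    simp [drivenBox, drivenChain]
  | succ n ih =>
    ext ξ
    have h1 : ξ ∈ {ξ | ∀ i ≤ n, drivenChain i ξ = x i} ↔
      ξ ∈ Set.pi (Finset.range (n + 1) : Set ℕ) (drivenBox x) := by rw [ih]
    have h2 : ξ ∈ Set.pi (Finset.range (n + 1 + 1) : Set ℕ) (drivenBox x) ↔
        ξ (n + 1) ∈ drivenBox x (n + 1) ∧
          ξ ∈ Set.pi (Finset.range (n + 1) : Set ℕ) (drivenBox x) := by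
      rw [Finset.range_add_one, Finset.coe_insert, Set.insert_pi]
      rfl
    have h3 : ξ ∈ {ξ | ∀ i ≤ n + 1, drivenChain i ξ = x i} ↔
        drivenChain (n + 1) ξ = x (n + 1) ∧ ξ ∈ {ξ | ∀ i ≤ n, drivenChain i ξ = x i} := by
      constructor
      · intro h
        exact ⟨h (n + 1) le_rfl, fun i hi => h i (hi.trans (Nat.le_succ n))⟩
      · rintro ⟨h, h'⟩ i hi
        rcases Nat.le_succ_iff.1 hi with h4 | h4
        · exact h' i h4
        · subst h4; exact h
    rw [h2, h3, ← h1]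
    refine and_congr_left fun h => ?_
    have h4 : drivenChain n ξ = x n := h n le_rfl
    simp only [drivenChain, drivenBox, h4]
    by_cases h5 : x n = 0
    · simp [h5]
    · by_cases h6 : x (n + 1) = x n - 1
      · simp [h5, h6]
      · simp [h5, h6, Ne.symm h6]

theorem exists_isMarkovChain {f ν : ℕ → ℝ} (hf : ∀ k, 0 ≤ f k) (hf1 : HasSum f 1)
    (hν : ∀ k, 0 ≤ ν k) (hν1 : HasSum ν 1) :
    ∃ μ : Measure (ℕ → ℕ), IsProbabilityMeasure μ ∧
      IsMarkovChain (transition f) μ (fun n ω => ω n) ∧ ∀ k, μ.real {ω | ω 0 = k} = ν k := by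
  obtain ⟨P, hP, hPf⟩ := exists_probabilityMeasure hf hf1
  obtain ⟨P₀, hP₀, hPν⟩ := exists_probabilityMeasure hν hν1
  obtain ⟨Q, hQ, hQ0, hQs⟩ : ∃ Q : ℕ → Measure ℕ, (∀ n, IsProbabilityMeasure (Q n)) ∧
      Q 0 = P₀ ∧ ∀ n, Q (n + 1) = P :=
    ⟨fun n => Nat.casesOn n P₀ fun _ => P, fun n => by cases n; exacts [hP₀, hP], rfl, fun _ => rfl⟩
  have hinf : IsProbabilityMeasure (Measure.infinitePi Q : Measure (ℕ → ℕ)) := inferInstance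
  have hinf : IsProbabilityMeasure (Measure.infinitePi Q : Measure (ℕ → ℕ)) := inferInstance
  have hpath : ∀ (n : ℕ) (x : ℕ → ℕ), (Measure.infinitePi Q).real
      {ξ | ∀ i ≤ n, drivenChain i ξ = x i} =
        ∏ i ∈ Finset.range (n + 1), (Q i).real (drivenBox x i) := fun n x => by
    rw [drivenChain_path_eq, measureReal_def, Measure.infinitePi_pi _
      (fun _ _ => MeasurableSet.of_discrete), ENNReal.toReal_prod]
    rfl
  have hmeas : Measurable fun ξ : ℕ → ℕ => fun n => drivenChain n ξ :=
    measurable_pi_lambda _ measurable_drivenChain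
  have hmap : ∀ (n : ℕ) (x : ℕ → ℕ), ((Measure.infinitePi Q).map
      fun ξ : ℕ → ℕ => fun n => drivenChain n ξ).real {ω | ∀ i ≤ n, ω i = x i} =
        ∏ i ∈ Finset.range (n + 1), (Q i).real (drivenBox x i) := fun n x => by
    rw [← hpath, map_measureReal_apply hmeas]
    · rfl
    · have hset : {ω : ℕ → ℕ | ∀ i ≤ n, ω i = x i} = ⋂ i, ⋂ _ : i ≤ n, {ω | ω i = x i} := by
        ext ω; simp
      rw [hset]
      exact MeasurableSet.iInter fun i => MeasurableSet.iInter fun _ =>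
        measurable_pi_apply i (measurableSet_singleton _)
  refine ⟨(Measure.infinitePi Q).map fun ξ : ℕ → ℕ => fun n => drivenChain n ξ,
    Measure.isProbabilityMeasure_map hmeas.aemeasurable, ⟨measurable_pi_apply, fun n x => ?_⟩,
    fun k => ?_⟩
  · rw [hmap, hmap, Finset.prod_range_succ]
    congr 1
    rw [hQs]
    simp only [drivenBox]
    rcases hx : x n with _ | i
    · simp [hPf, transition]
    · by_cases hi : x (n + 1) = i <;> simp [transition, hi]
  · have h := hmap 0 fun _ => k
    simp only [Nat.le_zero, forall_eq, zero_add, Finset.prod_range_one] at h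
    rw [h, hQ0]
    exact hPν k

end Existence

/-! ### The invariant law -/

section Equilibrium

variable {π₀ α : ℝ}

theorem hasSum_mul_transition (f ν : ℕ → ℝ) (j : ℕ) :
    HasSum (fun i => ν i * transition f i j) (ν 0 * f j + ν (j + 1)) := by
  have h := hasSum_sum_of_ne_finset_zero (s := {0, j + 1})
    (f := fun i => ν i * transition f i j) (L := .unconditional ℕ) (fun i hi => by
      rcases i with _ | i
      · simp at hi
      · have : ¬ j = i := fun h => hi (by simp [h])
        simp [transition, this])
  rw [Finset.sum_pair (by simp)] at h
  simpa [transition] using h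

/-- State j is entered only from 0 and j + 1, so invariance of a multiple of r reads r j = f j + r
(j + 1). -/
theorem isEquilibrium_survival (hπ₀ : 0 < π₀) (hπ₁ : π₀ < 1) (hα₀ : 0 < α) :
    IsEquilibrium (transition (jumpProb π₀ α)) fun i => π₀ * survival π₀ α i := by
  refine ⟨fun i => mul_nonneg hπ₀.le (survival_nonneg hπ₀ hπ₁ hα₀ i), ?_, fun j => ?_⟩
  · have h := (hasSum_survival hπ₀ hπ₁ hα₀).mul_left π₀
    rwa [mul_one_div_cancel hπ₀.ne'] at h
  · have h := hasSum_mul_transition (jumpProb π₀ α) (fun i => π₀ * survival π₀ α i) j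
    rw [survival_zero hπ₀, jumpProb_eq_sub hπ₀] at h
    convert h using 1
    ring

/-- The invariance recursion forces ν = ν 0 · r, and ∑ r = 1/π₀. -/
theorem IsEquilibrium.apply_zero (hπ₀ : 0 < π₀) (hπ₁ : π₀ < 1) (hα₀ : 0 < α) {ν : ℕ → ℝ}
    (hν : IsEquilibrium (transition (jumpProb π₀ α)) ν) : ν 0 = π₀ := by
  have hrec : ∀ j, ν j = ν 0 * survival π₀ α j := fun j => by
    induction j with
    | zero => rw [survival_zero hπ₀, mul_one]
    | succ j ih =>
      have h := (hν.invariant j).unique (hasSum_mul_transition _ _ j)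
      rw [jumpProb_eq_sub hπ₀] at h
      linarith
  have h1 := (hasSum_survival hπ₀ hπ₁ hα₀).mul_left (ν 0)
  have h2 := (hasSum_of_eq h1 hrec).unique hν.hasSum_one
  field_simp at h2
  exact h2

variable {Ω : Type*} [MeasurableSpace Ω] {μ : Measure Ω} {X : ℕ → Ω → ℕ} {p : ℕ → ℕ → ℝ}

theorem IsEquilibriumChain.measureReal_eq [IsFiniteMeasure μ] (hX : IsEquilibriumChain p μ X)
    (n j : ℕ) : μ.real {ω | X n ω = j} = μ.real {ω | X 0 ω = j} := by
  induction n generalizing j with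
  | zero => rfl
  | succ n ih =>
    have hm := hX.isMarkovChain.measurable
    have h1 := hasSum_measureReal_fiber (μ := μ) (hm n) (measurableSet_eq_nat hm (n + 1) j)
    refine h1.unique (hasSum_of_eq (hX.isEquilibrium.invariant j) fun i => ?_)
    have h2 := hX.isMarkovChain.measureReal_step (pastEvent_univ n) i j
    rw [Set.univ_inter, ih] at h2
    rw [Set.inter_comm, h2]

theorem exists_isEquilibriumChain (hπ₀ : 0 < π₀) (hπ₁ : π₀ < 1) (hα₀ : 0 < α)
    (hvalid : ((2 : ℝ) ^ α - 1) / ((2 : ℝ) ^ (α + 1) - 1) < π₀) :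
    ∃ μ : Measure (ℕ → ℕ), IsProbabilityMeasure μ ∧
      IsEquilibriumChain (transition (jumpProb π₀ α)) μ (fun n ω => ω n) := by
  have hν := isEquilibrium_survival hπ₀ hπ₁ hα₀
  obtain ⟨μ, hμ, hX, h0⟩ := exists_isMarkovChain (jumpProb_nonneg hπ₀ hπ₁ hα₀ hvalid)
    (hasSum_jumpProb hπ₀ hπ₁ hα₀ hvalid) hν.nonneg hν.hasSum_one
  refine ⟨μ, hμ, hX, ?_⟩
  simp_rw [h0]
  exact hν

end Equilibrium

/-! ### Return times, variance of visits, and covariances -/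

section Conclusion

open Topology

variable {π₀ α : ℝ} {Ω : Type*} [MeasurableSpace Ω] {μ : Measure Ω} {X : ℕ → Ω → ℕ}

theorem one_sub_returnCDF [IsProbabilityMeasure μ] {f r : ℕ → ℝ}
    (hX : IsMarkovChain (transition f) μ X) (hf : HasSum f 1)
    (hr : ∀ n, ∑ k ∈ Finset.range n, f k = 1 - r n) (h0 : μ {ω | X 0 ω = 0} ≠ 0) (n : ℕ) :
    1 - returnCDF μ X n = r n := by
  have hm := measurableSet_eq_nat hX.measurable 0 0
  have := cond_isProbabilityMeasure h0
  have hset : {ω | ∃ k, 1 ≤ k ∧ k ≤ n ∧ X k ω = 0} =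
      ⋃ k, ⋃ _ : 1 ≤ k, ⋃ _ : k ≤ n, {ω | X k ω = 0} := by
    ext ω
    simp only [Set.mem_iUnion, exists_prop]
    rfl
  have hmeas : MeasurableSet {ω | ∃ k, 1 ≤ k ∧ k ≤ n ∧ X k ω = 0} := by
    rw [hset]
    exact MeasurableSet.iUnion fun k => MeasurableSet.iUnion fun _ => MeasurableSet.iUnion fun _ =>
      measurableSet_eq_nat hX.measurable k 0
  have hcompl : {ω | ∃ k, 1 ≤ k ∧ k ≤ n ∧ X k ω = 0}ᶜ =
      {ω | ∀ k, 1 ≤ k → k ≤ n → X k ω ≠ 0} := by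
    ext ω; simp
  rw [returnCDF, ← probReal_compl_eq_one_sub hmeas, hcompl, measureReal_cond hm,
    measureReal_avoid hX hf hr, inv_mul_cancel_left₀]
  exact (measureReal_ne_zero_iff (measure_ne_top _ _)).2 h0

theorem tendsto_variance_visits [IsProbabilityMeasure μ] {f u : ℕ → ℝ} {D : ℝ} (hα₀ : 0 < α)
    (hα₁ : α < 1) (hX : IsMarkovChain (transition f) μ X) (hX0 : μ.real {ω | X 0 ω = 0} = 1)
    (hu0 : u 0 = 1) (hu : ∀ n, u (n + 1) = ∑ k ∈ Finset.range (n + 1), f k * u (n - k))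
    (hlim : Tendsto (fun n : ℕ => (u n - π₀) / (n : ℝ) ^ (-α)) atTop (𝓝 D)) :
    Tendsto (fun n : ℕ => variance (fun ω => (visits X n ω : ℝ)) μ / (n : ℝ) ^ (2 - α)) atTop
      (𝓝 (2 * π₀ * D * α / ((1 - α) * (2 - α)))) := by
  have hm := measurableSet_eq_nat hX.measurable
  have hvisit : ∀ i, μ.real {ω | X i ω = 0} = u i := fun i => by
    have h1 := measureReal_visit hX hu0 hu 0 i
    rw [hX0, one_mul, zero_add] at h1
    rw [← h1]
    have hae : ∀ᵐ ω ∂μ, X 0 ω = 0 := by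
      rw [ae_iff, ← Set.compl_ofPred, ← measureReal_eq_zero_iff,
        probReal_compl_eq_one_sub (hm 0 0), hX0, sub_self]
    refine measureReal_congr ?_
    filter_upwards [hae] with ω hω
    exact propext ⟨fun h => ⟨hω, h⟩, fun h => h.2⟩
  -- Starting from 0, visits at times i and i + k have joint probability u i · u k.
  have hcov : ∀ i k, covariance ({ω | X i ω = 0}.indicator (1 : Ω → ℝ))
      ({ω | X (i + k) ω = 0}.indicator (1 : Ω → ℝ)) μ = u i * (u k - u (i + k)) := fun i k => by
    rw [covariance_indicator_one (hm _ _) (hm _ _), measureReal_visit hX hu0 hu, hvisit, hvisit]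
    ring
  have hLp : ∀ i, MemLp ({ω | X i ω = 0}.indicator (1 : Ω → ℝ)) 2 μ := fun i =>
    memLp_indicator_one (hm i 0)
  refine tendsto_variance_div_rpow (d := fun n => u n - π₀) hα₀ hα₁ hlim ?_ fun n => ?_
  · have : (fun ω => (visits X 0 ω : ℝ)) = 0 := by
      funext ω; simp [visits]
    rw [this, variance_zero]
  · have hLpv : MemLp (fun ω => (visits X n ω : ℝ)) 2 μ := by
      rw [visits_eq_sum]
      exact memLp_finsetSum _ fun i _ => hLp (i + 1)
    have h1 : variance ({ω | X (n + 1) ω = 0}.indicator (1 : Ω → ℝ)) μ =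
        u (n + 1) - u (n + 1) ^ 2 := by
      rw [← covariance_self (hLp _).aestronglyMeasurable.aemeasurable]
      have := hcov (n + 1) 0
      rw [add_zero, hu0] at this
      rw [this]
      ring
    have h2 : covariance (fun ω => (visits X n ω : ℝ))
        ({ω | X (n + 1) ω = 0}.indicator (1 : Ω → ℝ)) μ =
          ∑ i ∈ Finset.range n, u (i + 1) * (u (n - i) - u (n + 1)) := by
      rw [visits_eq_sum, covariance_fun_sum_left' (fun i _ => hLp (i + 1)) (hLp _)]
      refine Finset.sum_congr rfl fun i hi => ?_
      have h3 := hcov (i + 1) (n - i)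
      rwa [show i + 1 + (n - i) = n + 1 by have := Finset.mem_range.1 hi; omega] at h3
    rw [visits_succ, variance_add hLpv (hLp _), h1, h2]
    simp only [add_sub_cancel]
    ring

theorem integral_binary [IsProbabilityMeasure μ] (hX : ∀ n, Measurable (X n)) (i : ℕ) :
    ∫ ω, binary X i ω ∂μ = 1 - μ.real {ω | X i ω = 0} := by
  have hm := measurableSet_eq_nat hX i 0
  rw [binary_eq_sub, integral_sub (integrable_const _)
    ((memLp_indicator_one hm).integrable one_le_two), integral_indicator_one hm]
  simp

theorem covariance_binary [IsProbabilityMeasure μ] (hX : ∀ n, Measurable (X n)) (i j : ℕ) :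
    covariance (binary X i) (binary X j) μ =
      μ.real ({ω | X i ω = 0} ∩ {ω | X j ω = 0}) -
        μ.real {ω | X i ω = 0} * μ.real {ω | X j ω = 0} := by
  have hi := measurableSet_eq_nat hX i 0
  have hj := measurableSet_eq_nat hX j 0
  rw [binary_eq_sub, binary_eq_sub,
    covariance_const_sub_left ((memLp_indicator_one hi).integrable one_le_two),
    covariance_const_sub_right ((memLp_indicator_one hj).integrable one_le_two), neg_neg,
    covariance_indicator_one hi hj]

theorem memLp_binary [IsProbabilityMeasure μ] (hX : ∀ n, Measurable (X n)) (i : ℕ) :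
    MemLp (binary X i) 2 μ := by
  rw [binary_eq_sub]
  exact (memLp_const 1).sub (memLp_indicator_one (measurableSet_eq_nat hX i 0))

theorem not_summable_abs_of_isEquivalent {ρ : ℕ → ℝ} {C : ℝ} (hC : 0 < C) (hα₁ : α < 1)
    (h : IsEquivalent atTop ρ fun n : ℕ => C * (n : ℝ) ^ (-α)) :
    ¬ Summable fun k : ℤ => |ρ k.natAbs| := by
  intro hs
  have h1 : Summable fun n : ℕ => |ρ n| := by
    simpa [Function.comp_def] using hs.comp_injective Nat.cast_injective
  have h2 := h.summable_iff_nat.1 h1.of_abs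
  rw [summable_mul_left_iff hC.ne', Real.summable_nat_rpow] at h2
  linarith

end Conclusion

/-! ### The asymptotic statements for the given jump law -/

section Conclusion

open Topology

variable {π₀ α : ℝ} {Ω : Type*} [MeasurableSpace Ω] {μ : Measure Ω} {X : ℕ → Ω → ℕ}

theorem isEquivalent_one_sub_returnCDF [IsProbabilityMeasure μ] (hπ₀ : 0 < π₀) (hπ₁ : π₀ < 1)
    (hα₀ : 0 < α) (hvalid : ((2 : ℝ) ^ α - 1) / ((2 : ℝ) ^ (α + 1) - 1) < π₀)
    (hX : IsMarkovChain (transition (jumpProb π₀ α)) μ X) (h0 : μ {ω | X 0 ω = 0} ≠ 0) :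
    IsEquivalent atTop (fun n : ℕ => 1 - returnCDF μ X n)
      (fun n : ℕ => α * (1 - π₀) / π₀ * (n : ℝ) ^ (-(1 + α))) := by
  have hC : 0 < α * (1 - π₀) / π₀ := div_pos (mul_pos hα₀ (by linarith)) hπ₀
  simp_rw [one_sub_returnCDF hX (hasSum_jumpProb hπ₀ hπ₁ hα₀ hvalid) (sum_range_jumpProb hπ₀) h0]
  exact isEquivalent_of_tendsto_div_rpow hC.ne' tendsto_survival_div_rpow

theorem isEquivalent_variance_visits [IsProbabilityMeasure μ] (hπ₀ : 0 < π₀) (hπ₁ : π₀ < 1)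
    (hα₀ : 0 < α) (hα₁ : α < 1) (hvalid : ((2 : ℝ) ^ α - 1) / ((2 : ℝ) ^ (α + 1) - 1) < π₀)
    (hX : IsMarkovChain (transition (jumpProb π₀ α)) μ X) (h0 : μ {ω | X 0 ω = 0} ≠ 0) :
    IsEquivalent atTop
      (fun n : ℕ => variance (fun ω => (visits X n ω : ℝ)) (cond μ {ω | X 0 ω = 0}))
      (fun n : ℕ => 2 * α * π₀ ^ 2 * (1 - π₀) / ((1 - α) * (2 - α)) * (n : ℝ) ^ (2 - α)) := by
  have hC : 0 < 2 * α * π₀ ^ 2 * (1 - π₀) / ((1 - α) * (2 - α)) :=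
    div_pos (mul_pos (by positivity) (by linarith)) (mul_pos (by linarith) (by linarith))
  obtain ⟨u, hu0, hu, hlim⟩ := exists_renewal hπ₀ hπ₁ hα₀ hα₁ hvalid
  have hν := cond_isProbabilityMeasure h0
  have h1 : (cond μ {ω | X 0 ω = 0}).real {ω | X 0 ω = 0} = 1 := by
    rw [measureReal_cond (measurableSet_eq_nat hX.measurable 0 0), Set.inter_self]
    exact inv_mul_cancel₀ ((measureReal_ne_zero_iff (measure_ne_top _ _)).2 h0)
  refine isEquivalent_of_tendsto_div_rpow hC.ne' ?_
  convert tendsto_variance_visits hα₀ hα₁ hX.cond_eq_zero h1 hu0 hu hlim using 2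
  ring

theorem IsEquilibriumChain.measureReal_zero [IsProbabilityMeasure μ] (hπ₀ : 0 < π₀) (hπ₁ : π₀ < 1)
    (hα₀ : 0 < α) (hX : IsEquilibriumChain (transition (jumpProb π₀ α)) μ X) (i : ℕ) :
    μ.real {ω | X i ω = 0} = π₀ := by
  rw [hX.measureReal_eq]
  exact hX.isEquilibrium.apply_zero hπ₀ hπ₁ hα₀

/-- State 0 has mass π₀ at all times, and a return k steps later has probability u k whatever the
time, so only the lag matters. -/
theorem IsEquilibriumChain.covariance_binary_add [IsProbabilityMeasure μ] (hπ₀ : 0 < π₀)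
    (hπ₁ : π₀ < 1) (hα₀ : 0 < α) {u : ℕ → ℝ} (hu0 : u 0 = 1)
    (hu : ∀ n, u (n + 1) = ∑ k ∈ Finset.range (n + 1), jumpProb π₀ α k * u (n - k))
    (hX : IsEquilibriumChain (transition (jumpProb π₀ α)) μ X) (i k : ℕ) :
    covariance (binary X i) (binary X (i + k)) μ = π₀ * (u k - π₀) := by
  rw [covariance_binary hX.isMarkovChain.measurable, measureReal_visit hX.isMarkovChain hu0 hu,
    hX.measureReal_zero hπ₀ hπ₁ hα₀, hX.measureReal_zero hπ₀ hπ₁ hα₀]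
  ring

theorem IsEquilibriumChain.isWeaklyStationary_binary [IsProbabilityMeasure μ] (hπ₀ : 0 < π₀)
    (hπ₁ : π₀ < 1) (hα₀ : 0 < α) (hα₁ : α < 1)
    (hvalid : ((2 : ℝ) ^ α - 1) / ((2 : ℝ) ^ (α + 1) - 1) < π₀)
    (hX : IsEquilibriumChain (transition (jumpProb π₀ α)) μ X) :
    IsWeaklyStationary μ (binary X) := by
  obtain ⟨u, hu0, hu, -⟩ := exists_renewal hπ₀ hπ₁ hα₀ hα₁ hvalid
  have hm := hX.isMarkovChain.measurable
  refine ⟨memLp_binary hm, fun i => ?_, fun i k => ?_⟩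
  · rw [integral_binary hm, integral_binary hm, hX.measureReal_eq]
  · have h := hX.covariance_binary_add hπ₀ hπ₁ hα₀ hu0 hu 0 k
    rw [zero_add] at h
    rw [h, hX.covariance_binary_add hπ₀ hπ₁ hα₀ hu0 hu]

theorem IsEquilibriumChain.isEquivalent_acf [IsProbabilityMeasure μ] (hπ₀ : 0 < π₀)
    (hπ₁ : π₀ < 1) (hα₀ : 0 < α) (hα₁ : α < 1)
    (hvalid : ((2 : ℝ) ^ α - 1) / ((2 : ℝ) ^ (α + 1) - 1) < π₀)
    (hX : IsEquilibriumChain (transition (jumpProb π₀ α)) μ X) :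
    IsEquivalent atTop (fun n : ℕ => acf μ (binary X) n) fun n : ℕ => π₀ * (n : ℝ) ^ (-α) := by
  obtain ⟨u, hu0, hu, hlim⟩ := exists_renewal hπ₀ hπ₁ hα₀ hα₁ hvalid
  have hcov := hX.covariance_binary_add hπ₀ hπ₁ hα₀ hu0 hu 0
  have hvar : variance (binary X 0) μ = π₀ * (1 - π₀) := by
    rw [← covariance_self
      (memLp_binary hX.isMarkovChain.measurable 0).aestronglyMeasurable.aemeasurable]
    simpa [hu0] using hcov 0
  have h1 : 1 - π₀ ≠ 0 := by linarith
  have hlim' := hlim.div_const (1 - π₀)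
  rw [mul_div_cancel_right₀ _ h1] at hlim'
  refine isEquivalent_of_tendsto_div_rpow hπ₀.ne' (hlim'.congr fun n => ?_)
  have h2 := hcov n
  rw [zero_add] at h2
  rw [acf, h2, hvar, mul_div_mul_left _ _ hπ₀.ne', div_right_comm]

end Conclusion

end LRDChain

theorem mainTheorem2 (π₀ α : ℝ) (hπ₀ : 0 < π₀) (hπ₁ : π₀ < 1) (hα₀ : 0 < α) (hα₁ : α < 1)
    (hvalid : ((2 : ℝ) ^ α - 1) / ((2 : ℝ) ^ (α + 1) - 1) < π₀) :
    -- the `f k` are probabilities and the equilibrium chain exists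
    ((∀ k, 0 ≤ LRDChain.jumpProb π₀ α k) ∧ HasSum (LRDChain.jumpProb π₀ α) 1) ∧
    (∃ μ : Measure (ℕ → ℕ), IsProbabilityMeasure μ ∧
      LRDChain.IsEquilibriumChain (LRDChain.transition (LRDChain.jumpProb π₀ α)) μ
        (fun n ω => ω n)) ∧
    -- return times to `0` and number of visits to `0`, given that the chain is in `0` at time `0`
    (∀ (Ω : Type*) [MeasurableSpace Ω] (μ : Measure Ω) [IsProbabilityMeasure μ] (X : ℕ → Ω → ℕ),
      LRDChain.IsMarkovChain (LRDChain.transition (LRDChain.jumpProb π₀ α)) μ X →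
      μ {ω | X 0 ω = 0} ≠ 0 →
        IsEquivalent atTop (fun n : ℕ => 1 - LRDChain.returnCDF μ X n)
          (fun n : ℕ => α * (1 - π₀) / π₀ * (n : ℝ) ^ (-(1 + α))) ∧
        IsEquivalent atTop
          (fun n : ℕ => variance (fun ω => (LRDChain.visits X n ω : ℝ))
            (cond μ {ω | X 0 ω = 0}))
          (fun n : ℕ => 2 * α * π₀ ^ 2 * (1 - π₀) / ((1 - α) * (2 - α)) *
            (n : ℝ) ^ (2 - α))) ∧
    -- mean, autocorrelation and long-range dependence of the binary series in equilibrium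
    (∃ C : ℝ, 0 < C ∧
      ∀ (Ω : Type*) [MeasurableSpace Ω] (μ : Measure Ω) [IsProbabilityMeasure μ]
        (X : ℕ → Ω → ℕ),
        LRDChain.IsEquilibriumChain (LRDChain.transition (LRDChain.jumpProb π₀ α)) μ X →
          (∀ i, ∫ ω, LRDChain.binary X i ω ∂μ = 1 - π₀) ∧
          IsEquivalent atTop (fun n : ℕ => LRDChain.acf μ (LRDChain.binary X) n)
            (fun n : ℕ => C * (n : ℝ) ^ (-α)) ∧
          LRDChain.IsLRD μ (LRDChain.binary X) ∧
          LRDChain.HasHurstParameter μ (LRDChain.binary X) (1 - α / 2)) := by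
  refine ⟨⟨LRDChain.jumpProb_nonneg hπ₀ hπ₁ hα₀ hvalid,
    LRDChain.hasSum_jumpProb hπ₀ hπ₁ hα₀ hvalid⟩,
    LRDChain.exists_isEquilibriumChain hπ₀ hπ₁ hα₀ hvalid, fun Ω _ μ _ X hX h0 =>
    ⟨LRDChain.isEquivalent_one_sub_returnCDF hπ₀ hπ₁ hα₀ hvalid hX h0,
      LRDChain.isEquivalent_variance_visits hπ₀ hπ₁ hα₀ hα₁ hvalid hX h0⟩,
    π₀, hπ₀, fun Ω _ μ _ X hX => ?_⟩
  have hacf := hX.isEquivalent_acf hπ₀ hπ₁ hα₀ hα₁ hvalid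
  refine ⟨fun i => ?_, hacf, ⟨hX.isWeaklyStationary_binary hπ₀ hπ₁ hα₀ hα₁ hvalid,
    LRDChain.not_summable_abs_of_isEquivalent hπ₀ hα₁ hacf⟩,
    α, π₀, hα₀, hα₁, hπ₀, hacf, rfl⟩
  rw [LRDChain.integral_binary hX.isMarkovChain.measurable,
    hX.measureReal_zero hπ₀ hπ₁ hα₀]
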